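/- Fix three closed "positive" cones of opening angle $\pi/3$ in the plane, with bisectors pointing in the directions $90^\circ$, $210^\circ$, $330^\circ$; translated to the apex $u$ they are the positive cones of $u$. A finite point set $P\subset\mathbb R^2$ is in general position if no two of its points lie on a line parallel to a cone boundary (i.e. of direction $0^\circ$, $60^\circ$ or $120^\circ$). The half-$\Theta_6$-graph of such a $P$ joins every $u\in P$, for each of its positive cones containing other points of $P$, to the point of $P$ in that cone whose orthogonal projection onto the bisector of the cone is closest to $u$. A deterministic $k$-local $0$-memory routing algorithm is a function that assigns, on every half-$\Theta_6$-graph, to the current vertex $s$, the destination $t\ne s$ and the set $N_k(s)$ of vertices reachable from $s$ by at most $k$ edges (and to nothing else) a neighbour of $s$ to which the message is forwarded; the message stops when it reaches $t$. The length of a route is the total Euclidean length of the edges traversed ($\infty$ if $t$ is never reached). The algorithm is $d$-competitive if it always reaches the destination and the length of the route is always at most $d$ times the Euclidean distance between source and destination; its routing ratio is the least such $d$. For points $u,w$ with $w$ in a positive cone of $u$, let $\alpha\in[0,\pi/6]$ be the unsigned angle between the segment $uw$ and the bisector of that cone, and put $$B^+(u,w)=(\sqrt3\cos\alpha+\sin\alpha)\,|uw|,\qquad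 B^-(u,w)=\Bigl(\tfrac5{\sqrt3}\cos\alpha-\sin\alpha\Bigr)|uw| .$$ (1) There is a single deterministic $1$-local $0$-memory routing algorithm such that, for every finite $P$ in general position and all $u,w\in P$ with $w$ in a positive cone of $u$, on the half-$\Theta_6$-graph of $P$ it reaches $w$ from $u$ along a route of length at most $B^+(u,w)$, and it reaches $u$ from $w$ along a route of length at most $B^-(u,w)$. Its routing ratio is exactly $5/\sqrt3$. (2) Both bounds are best possible: for every $k$, every deterministic $k$-local $0$-memory routing algorithm, all points $u,w$ such that $\{u,w\}$ is in general position and $w$ is in a positive cone of $u$, and every $\varepsilon>0$, there is a finite $P\ni u,w$ in general position for which the route from $u$ to $w$ is longer than $B^+(u,w)-\varepsilon$, and there is such a $P$ for which the route from $w$ to $u$ is longer than $B^-(u,w)-\varepsilon$. (3) For every $k$, no deterministic $k$-local $0$-memory routing algorithm is $d$-competitive with $d<5/\sqrt3$. (4) In contrast, the spanning ratio of the half-$\Theta_6$-graph is $2$: the least $d$ such that, for every finite $P$ in general position and all $u,v\in P$, the half-$\Theta_6$-graph of $P$ contains a path between $u$ and $v$ of length at most $d\,|uv|$, is $d=2$.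 -/

import Mathlib

open scoped ENNReal

/-- The Euclidean plane. -/
abbrev Plane : Type := EuclideanSpace ℝ (Fin 2)

namespace HalfTheta6

/-- The unit vectors along the bisectors of the three positive cones
(pointing up, to the lower left and to the lower right). -/
noncomputable def bisector : Fin 3 → Plane :=
  ![!₂[0, 1], !₂[-(√3 / 2), -(1 / 2)], !₂[√3 / 2, -(1 / 2)]]

/-- The positive cone number `i` with apex `u`: it has opening angle `π / 3` around its bisector.
The apex itself is not in it, since `angle 0 _ = π / 2`. The negative cones are the reflections
of the positive ones in their apex: `u` is in the negative cone `i` of `v` iff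
`v ∈ positiveCone i u`. -/
def positiveCone (i : Fin 3) (u : Plane) : Set Plane :=
  {v | InnerProductGeometry.angle (v - u) (bisector i) ≤ Real.pi / 6}

/-- The three directions of the cone boundaries (0, 60 and 120 degrees). -/
noncomputable def boundaryDirection : Fin 3 → Plane :=
  ![!₂[1, 0], !₂[1 / 2, √3 / 2], !₂[-(1 / 2), √3 / 2]]

/-- No two points lie on a line parallel to a cone boundary. -/
def GeneralPosition (S : Set Plane) : Prop :=
  ∀ u ∈ S, ∀ v ∈ S, u ≠ v → ∀ (i : Fin 3) (c : ℝ), v - u ≠ c • boundaryDirection i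

/-- Among the points of `P` in the positive cone `i` of `u`, the point `v` has the closest
projection onto the bisector of that cone. -/
def IsClosest (P : Finset Plane) (i : Fin 3) (u v : Plane) : Prop :=
  u ∈ P ∧ v ∈ P ∧ v ∈ positiveCone i u ∧
    ∀ x ∈ P, x ∈ positiveCone i u →
      inner ℝ (v - u) (bisector i) ≤ inner ℝ (x - u) (bisector i)

/-- The half-Θ₆-graph of `P`: each point of `P` is joined to the closest point of `P` in each of
its positive cones. (Points of the plane outside `P` are isolated and play no role.) -/
def halfTheta6Graph (P : Finset Plane) : SimpleGraph Plane :=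
  SimpleGraph.fromRel fun u v => ∃ i, IsClosest P i u v

/-- The vertices that can be reached from `s` by following at most `k` edges. -/
def neighbourhood (P : Finset Plane) (k : ℕ) (s : Plane) : Set Plane :=
  {v | ∃ p : (halfTheta6Graph P).Walk s v, p.length ≤ k}

/-- A deterministic `k`-local 0-memory routing algorithm on half-Θ₆-graphs: the vertex to which
a message is forwarded is a function of the current vertex `s`, the destination `t` and the
`k`-neighbourhood of `s` only, and it is always adjacent to `s`. -/
structure LocalRouting (k : ℕ) where
  /-- The forwarding function; its arguments are `s`, `t` and the `k`-neighbourhood of `s`. -/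
  forward : Plane → Plane → Set Plane → Plane
  /-- Messages travel along edges. -/
  adj_forward : ∀ P : Finset Plane, GeneralPosition (P : Set Plane) →
    ∀ s ∈ P, ∀ t ∈ P, s ≠ t →
      (halfTheta6Graph P).Adj s (forward s t (neighbourhood P k s))

namespace LocalRouting

variable {k : ℕ}

open scoped Classical in
/-- The position of the message after `n` steps when routing from `s` to `t` in the
half-Θ₆-graph of `P`. The message stays at `t` once it is there. -/
noncomputable def route (A : LocalRouting k) (P : Finset Plane) (s t : Plane) : ℕ → Plane
  | 0 => s
  | n + 1 =>
    if A.route P s t n = t then t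
    else A.forward (A.route P s t n) t (neighbourhood P k (A.route P s t n))

/-- The message sent from `s` arrives at `t`. -/
def Delivers (A : LocalRouting k) (P : Finset Plane) (s t : Plane) : Prop :=
  ∃ n, A.route P s t n = t

/-- The total distance travelled by the message (`∞` if it never arrives). -/
noncomputable def routeLength (A : LocalRouting k) (P : Finset Plane) (s t : Plane) : ℝ≥0∞ :=
  ∑' n, edist (A.route P s t n) (A.route P s t (n + 1))

/-- On every half-Θ₆-graph, the total distance travelled by the message is at most `d` times the
distance between source and destination. The routing ratio of `A` is the least such `d`. -/
def IsCompetitive (A : LocalRouting k) (d : ℝ) : Prop :=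
  ∀ P : Finset Plane, GeneralPosition (P : Set Plane) → ∀ s ∈ P, ∀ t ∈ P,
    A.Delivers P s t ∧ A.routeLength P s t ≤ ENNReal.ofReal (d * dist s t)

end LocalRouting

/-- Every half-Θ₆-graph contains, between any two of its vertices, a path of length at most `d`
times their distance. The spanning ratio of the half-Θ₆-graph is the least such `d`. -/
def IsSpanner (d : ℝ) : Prop :=
  ∀ P : Finset Plane, GeneralPosition (P : Set Plane) → ∀ u ∈ P, ∀ v ∈ P,
    ∃ p : (halfTheta6Graph P).Walk u v,
      (p.darts.map fun e => dist e.fst e.snd).sum ≤ d * dist u v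

/-- The unsigned angle between the line from `u` to `w` and the bisector of the cone `i` of `u`;
for `w` in that cone, the bisector passes through the midpoint of the side opposite to `u` of the
canonical triangle of `u` and `w`. -/
noncomputable def bisectorAngle (i : Fin 3) (u w : Plane) : ℝ :=
  InnerProductGeometry.angle (w - u) (bisector i)

/-- The bound `(√3 cos α + sin α) |uw|` for routing from `u` to `w`. -/
noncomputable def positiveBound (i : Fin 3) (u w : Plane) : ℝ :=
  (√3 * Real.cos (bisectorAngle i u w) + Real.sin (bisectorAngle i u w)) * dist u w

/-- The bound `(5 / √3 cos α - sin α) |uw|` for routing from `w` to `u`. -/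
noncomputable def negativeBound (i : Fin 3) (u w : Plane) : ℝ :=
  (5 / √3 * Real.cos (bisectorAngle i u w) - Real.sin (bisectorAngle i u w)) * dist u w

end HalfTheta6

/-! Everything is linear in the three coordinates `coord i`, which sum to zero and whose level lines
are parallel to the cone boundaries. A cone is given by two linear inequalities, and `dist_le`
bounds an edge by two coordinate differences. For `w` in the cone `i` of `u`, the canonical triangle
has side `coord i w - coord i u`. Then B⁺ is one side plus the distance from `w` to the farther
corner of the edge opposite `u`, and B⁻ is two sides plus the distance from `w` to the nearer corner
(`positiveBound_eq`, `negativeBound_eq`).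

Upper bounds: each non-terminal case of `Potential` is the length of a walk along the boundary of
the canonical triangle of `s` and `t`. If `s` lies in a positive cone of `t`, the walk goes to one
corner, across to the other and down to `t`; if the triangle is known to be empty on one side of
`s`, it goes directly to the corner on the other side and then to `t`. Every step lowers the
potential by at least the length of its edge (`Step.exists_potential`), and edges of a finite graph
have a positive minimal length, so the message arrives within the initial potential. No memory is
needed: emptiness of a side is visible from the neighbours of `s` (`coord_le_of_neighbourhood`) and
is preserved by hugging that side.

Lower bounds: in a `Zigzag` the points descend towards `u`, alternating between the two corners, and
only the last one is joined to `u`. The `k`-neighbourhood of `w` does not show where the zigzag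
ends, so the end can be put at the corner opposite to the first step; this forces B⁻. Taking one or
two points beyond `w` forces B⁺ for every path out of `u`.

Spanning ratio: B⁺ is at most twice the distance, and with `w` near a corner B⁺ tends to two sides
while the distance is at most one side. -/

namespace HalfTheta6

/-! ### Triangular coordinates -/

/-- The coordinate of a point in the direction of the bisector `i`, scaled such that
the canonical triangle of `u` and `v` in the cone `i` has side `coord i v - coord i u`. -/
noncomputable def coord (i : Fin 3) (v : Plane) : ℝ := 2 / √3 * inner ℝ v (bisector i)

/-- `i`, `j`, `l` are the three indices of the cones, in some order. -/
def Distinct (i j l : Fin 3) : Prop := i ≠ j ∧ i ≠ l ∧ j ≠ l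

instance (i j l : Fin 3) : Decidable (Distinct i j l) := by unfold Distinct; infer_instance

theorem Distinct.swap {i j l : Fin 3} (h : Distinct i j l) : Distinct i l j :=
  ⟨h.2.1, h.1, h.2.2.symm⟩

theorem Distinct.rotate {i j l : Fin 3} (h : Distinct i j l) : Distinct j l i :=
  ⟨h.2.2, h.1.symm, h.2.1.symm⟩

theorem exists_distinct (i : Fin 3) : ∃ j l, Distinct i j l := by
  revert i; decide

theorem Distinct.eq_or {i j l : Fin 3} (h : Distinct i j l) (x : Fin 3) :
    x = i ∨ x = j ∨ x = l := by
  revert i j l x; decide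

theorem coord_zero (v : Plane) : coord 0 v = 2 / √3 * v 1 := by
  simp [coord, bisector, PiLp.inner_apply, Fin.sum_univ_two]

theorem coord_one (v : Plane) : coord 1 v = -v 0 - v 1 / √3 := by
  have h : (√3 : ℝ) ≠ 0 := by positivity
  simp [coord, bisector, PiLp.inner_apply, Fin.sum_univ_two]
  field_simp
  ring

theorem coord_two (v : Plane) : coord 2 v = v 0 - v 1 / √3 := by
  have h : (√3 : ℝ) ≠ 0 := by positivity
  simp [coord, bisector, PiLp.inner_apply, Fin.sum_univ_two]
  field_simp
  ring

theorem coord_sub (i : Fin 3) (u v : Plane) : coord i (u - v) = coord i u - coord i v := by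
  simp [coord, inner_sub_left, mul_sub]

theorem coord_add_coord_add_coord {i j l : Fin 3} (h : Distinct i j l) (v : Plane) :
    coord i v + coord j v + coord l v = 0 := by
  have key : coord 0 v + coord 1 v + coord 2 v = 0 := by
    rw [coord_zero, coord_one, coord_two]; ring
  fin_cases i <;> fin_cases j <;> fin_cases l <;> simp [Distinct] at h <;>
    simp at * <;> linarith

theorem norm_sq_eq {i j l : Fin 3} (h : Distinct i j l) (v : Plane) :
    ‖v‖ ^ 2 = coord i v ^ 2 + coord i v * coord j v + coord j v ^ 2 := by
  have key : ‖v‖ ^ 2 = (coord 0 v ^ 2 + coord 1 v ^ 2 + coord 2 v ^ 2) / 2 := by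
    have h3 : (√3 : ℝ) ^ 2 = 3 := Real.sq_sqrt (by norm_num)
    have h : (√3 : ℝ) ≠ 0 := by positivity
    rw [coord_zero, coord_one, coord_two, EuclideanSpace.norm_sq_eq]
    simp only [Fin.sum_univ_two, Real.norm_eq_abs, sq_abs]
    field_simp
    ring_nf
    rw [h3]; ring
  have hs := coord_add_coord_add_coord h v
  have key2 : ‖v‖ ^ 2 = (coord i v ^ 2 + coord j v ^ 2 + coord l v ^ 2) / 2 := by
    rw [key]
    clear hs key
    fin_cases i <;> fin_cases j <;> fin_cases l <;> simp [Distinct] at h <;> simp <;> ring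
  have : coord l v = -(coord i v + coord j v) := by linarith
  rw [key2, this]; ring

theorem dist_sq_eq {i j l : Fin 3} (h : Distinct i j l) (u v : Plane) :
    dist u v ^ 2 = (coord i u - coord i v) ^ 2 + (coord i u - coord i v) * (coord j u - coord j v)
      + (coord j u - coord j v) ^ 2 := by
  rw [dist_eq_norm, norm_sq_eq h, coord_sub, coord_sub]

/-- The right side is the length of a two-segment path between the points parallel to cone
boundaries. Potentials are sums of such lengths, so this is how edge lengths are compared with them.
-/
theorem dist_le {i j l : Fin 3} (h : Distinct i j l) (u v : Plane) :
    dist u v ≤ |coord i u - coord i v| + |coord j u - coord j v| := by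
  apply abs_le_of_sq_le_sq' _ (by positivity) |>.2
  rw [dist_sq_eq h]
  set a := coord i u - coord i v
  set b := coord j u - coord j v
  have := le_abs_self (a * b)
  rw [abs_mul] at this
  nlinarith [sq_abs a, sq_abs b, abs_nonneg a, abs_nonneg b]

/-- Points with prescribed coordinates. -/
theorem exists_coord_eq {i j l : Fin 3} (h : Distinct i j l) (a b : ℝ) :
    ∃ v : Plane, coord i v = a ∧ coord j v = b := by
  have key : ∀ x y z : ℝ, x + y + z = 0 →
      ∃ v : Plane, coord 0 v = x ∧ coord 1 v = y ∧ coord 2 v = z := by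
    intro x y z hs
    have h3 : (√3 : ℝ) ≠ 0 := by positivity
    refine ⟨!₂[(z - y) / 2, √3 / 2 * x], ?_, ?_, ?_⟩
    · rw [coord_zero]; simp; field_simp
    · rw [coord_one]; simp; field_simp; linarith
    · rw [coord_two]; simp; field_simp; linarith
  have k01 := key a b (-a - b) (by ring)
  have k02 := key a (-a - b) b (by ring)
  have k10 := key b a (-a - b) (by ring)
  have k12 := key (-a - b) a b (by ring)
  have k20 := key b (-a - b) a (by ring)
  have k21 := key (-a - b) b a (by ring)
  fin_cases i <;> fin_cases j <;> fin_cases l <;> simp [Distinct] at h <;> simp <;> grind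

theorem inner_bisector (i : Fin 3) (v : Plane) : inner ℝ v (bisector i) = √3 / 2 * coord i v := by
  have h3 : (√3 : ℝ) ≠ 0 := by positivity
  rw [coord]; field_simp

theorem norm_bisector (i : Fin 3) : ‖bisector i‖ = 1 := by
  have h3 : (√3 : ℝ) ^ 2 = 3 := Real.sq_sqrt (by norm_num)
  fin_cases i <;> simp [bisector, EuclideanSpace.norm_eq, Fin.sum_univ_two, div_pow, h3] <;>
    norm_num

/-- With `d = v - u` nonzero, the angle condition reads `‖d‖ ≤ coord i d`. For `b`, `c` the other
two coordinates of `d`, `‖d‖² = (b + c)² - b c` and `coord i d = -(b + c)`, so it says that `b` and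
`c` are both nonpositive. -/
theorem mem_positiveCone {i j l : Fin 3} (h : Distinct i j l) {u v : Plane} :
    v ∈ positiveCone i u ↔ v ≠ u ∧ coord j v ≤ coord j u ∧ coord l v ≤ coord l u := by
  have h3 : (0 : ℝ) < √3 := by positivity
  rcases eq_or_ne v u with rfl | hne
  · simp only [positiveCone, Set.mem_ofPred_eq, sub_self, InnerProductGeometry.angle_zero_left]
    simp; linarith [Real.pi_pos]
  have hd : 0 < ‖v - u‖ := norm_pos_iff.2 (sub_ne_zero.2 hne)
  have h1 : v ∈ positiveCone i u ↔ ‖v - u‖ ≤ coord i (v - u) := by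
    simp only [positiveCone, Set.mem_ofPred_eq]
    rw [← Real.strictAntiOn_cos.le_iff_ge ⟨by positivity, by linarith [Real.pi_pos]⟩
      ⟨InnerProductGeometry.angle_nonneg _ _, InnerProductGeometry.angle_le_pi _ _⟩,
      InnerProductGeometry.cos_angle, norm_bisector, mul_one, le_div_iff₀ hd, inner_bisector,
      Real.cos_pi_div_six]
    exact mul_le_mul_iff_right₀ (by positivity)
  rw [h1, ← sub_nonpos (a := coord j v), ← sub_nonpos (a := coord l v), ← coord_sub, ← coord_sub]
  have hs := coord_add_coord_add_coord h (v - u)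
  have hn := norm_sq_eq h.rotate (v - u)
  set a := coord i (v - u)
  set b := coord j (v - u)
  set c := coord l (v - u)
  have ha : a = -(b + c) := by linarith
  simp only [ne_eq, hne, not_false_eq_true, true_and]
  constructor
  · intro hle
    have : 0 ≤ b * c := by nlinarith
    have : b + c < 0 := by linarith
    constructor <;> by_contra! hb <;> nlinarith
  · rintro ⟨hb, hc⟩
    apply abs_le_of_sq_le_sq' _ (by linarith) |>.2
    rw [hn, ha]; nlinarith

/-! ### General position and adjacency in coordinates -/

theorem generalPosition_iff {S : Set Plane} :
    GeneralPosition S ↔ ∀ u ∈ S, ∀ v ∈ S, u ≠ v → ∀ i, coord i u ≠ coord i v := by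
  have h3 : (√3 : ℝ) ≠ 0 := by positivity
  have key0 (d : Plane) : (∃ c : ℝ, d = c • !₂[1, 0]) ↔ coord 0 d = 0 := by
    rw [coord_zero]
    constructor
    · rintro ⟨c, rfl⟩
      simp
    · intro hd
      have : d 1 = 0 := by simpa using hd
      refine ⟨d 0, ?_⟩
      ext m; fin_cases m <;> simp [this]
  have key1 (d : Plane) : (∃ c : ℝ, d = c • !₂[1 / 2, √3 / 2]) ↔ coord 2 d = 0 := by
    rw [coord_two]
    constructor
    · rintro ⟨c, rfl⟩
      simp; field_simp; simp
    · intro hd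
      have : d 1 = √3 * d 0 := by field_simp at hd; linarith
      refine ⟨2 * d 0, ?_⟩
      ext m; fin_cases m <;> simp [this] <;> ring
  have key2 (d : Plane) : (∃ c : ℝ, d = c • !₂[-(1 / 2), √3 / 2]) ↔ coord 1 d = 0 := by
    rw [coord_one]
    constructor
    · rintro ⟨c, rfl⟩
      simp; field_simp; simp
    · intro hd
      have : d 1 = -(√3 * d 0) := by field_simp at hd; linarith
      refine ⟨-2 * d 0, ?_⟩
      ext m; fin_cases m <;> simp [this] <;> ring
  -- Negation on `Fin 3` fixes 0 and exchanges 1 and 2, matching each boundary direction with the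
  -- coordinate that is constant along it.
  have key (i : Fin 3) (d : Plane) : (∃ c : ℝ, d = c • boundaryDirection i) ↔
      coord (-i) d = 0 := by
    fin_cases i
    exacts [key0 d, key1 d, key2 d]
  constructor
  · intro h u hu v hv hne i heq
    have := (key (-i) (v - u)).2 (by rw [neg_neg, coord_sub, heq, sub_self])
    obtain ⟨c, hc⟩ := this
    exact h u hu v hv hne _ c hc
  · intro h u hu v hv hne i c hc
    have := (key i (v - u)).1 ⟨c, hc⟩
    rw [coord_sub] at this
    exact h u hu v hv hne (-i) (by linarith)

theorem isClosest_iff {P : Finset Plane} {i j l : Fin 3} (h : Distinct i j l) {u v : Plane} :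
    IsClosest P i u v ↔ u ∈ P ∧ v ∈ P ∧ v ≠ u ∧ coord j v ≤ coord j u ∧ coord l v ≤ coord l u ∧
      ∀ x ∈ P, x ≠ u → coord j x ≤ coord j u → coord l x ≤ coord l u → coord i v ≤ coord i x := by
  have h3 : (0 : ℝ) < √3 := by positivity
  simp only [IsClosest, mem_positiveCone h, inner_bisector, coord_sub]
  have : ∀ x, √3 / 2 * (coord i v - coord i u) ≤ √3 / 2 * (coord i x - coord i u) ↔
      coord i v ≤ coord i x := by
    intro x
    rw [mul_le_mul_iff_right₀ (by positivity)]
    constructor <;> intro <;> linarith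
  simp only [this]
  grind

theorem exists_isClosest {P : Finset Plane} {i : Fin 3} {u x : Plane} (hu : u ∈ P) (hx : x ∈ P)
    (hc : x ∈ positiveCone i u) : ∃ v, IsClosest P i u v := by
  classical
  obtain ⟨v, hv, hmin⟩ := (P.filter (· ∈ positiveCone i u)).exists_min_image
    (fun y => inner ℝ (y - u) (bisector i)) ⟨x, by simp [hx, hc]⟩
  simp only [Finset.mem_filter] at hv hmin
  exact ⟨v, hu, hv.1, hv.2, fun y hy hyc => hmin y ⟨hy, hyc⟩⟩

theorem adj_iff {P : Finset Plane} {u v : Plane} :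
    (halfTheta6Graph P).Adj u v ↔
      u ≠ v ∧ ((∃ i, IsClosest P i u v) ∨ ∃ i, IsClosest P i v u) := by
  simp [halfTheta6Graph, SimpleGraph.fromRel_adj]

theorem IsClosest.ne {P : Finset Plane} {i : Fin 3} {u v : Plane} (h : IsClosest P i u v) :
    v ≠ u := by
  obtain ⟨j, l, hd⟩ := exists_distinct i
  exact ((isClosest_iff hd).1 h).2.2.1

theorem IsClosest.adj {P : Finset Plane} {i : Fin 3} {u v : Plane} (h : IsClosest P i u v) :
    (halfTheta6Graph P).Adj u v :=
  adj_iff.2 ⟨h.ne.symm, Or.inl ⟨i, h⟩⟩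

theorem mem_of_adj {P : Finset Plane} {u v : Plane} (h : (halfTheta6Graph P).Adj u v) :
    u ∈ P ∧ v ∈ P := by
  rcases adj_iff.1 h with ⟨-, ⟨i, h⟩ | ⟨i, h⟩⟩
  exacts [⟨h.1, h.2.1⟩, ⟨h.2.1, h.1⟩]

theorem mem_neighbourhood_one {P : Finset Plane} {s v : Plane} :
    v ∈ neighbourhood P 1 s ↔ v = s ∨ (halfTheta6Graph P).Adj s v := by
  constructor
  · rintro ⟨p, hp⟩
    cases p with
    | nil => exact Or.inl rfl
    | cons h q =>
      cases q with
      | nil => exact Or.inr h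
      | cons h' q' => simp at hp
  · rintro (rfl | h)
    · exact ⟨SimpleGraph.Walk.nil, by simp⟩
    · exact ⟨h.toWalk, by simp⟩

/-! ### The two bounds in coordinates -/

theorem cos_bisectorAngle_mul_dist (i : Fin 3) (u w : Plane) :
    Real.cos (bisectorAngle i u w) * dist u w = √3 / 2 * (coord i w - coord i u) := by
  rw [dist_comm, dist_eq_norm, ← coord_sub, ← inner_bisector, bisectorAngle]
  have := InnerProductGeometry.cos_angle_mul_norm_mul_norm (w - u) (bisector i)
  rwa [norm_bisector, mul_one] at this

theorem sin_bisectorAngle_mul_dist {i j l : Fin 3} (h : Distinct i j l) (u w : Plane) :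
    Real.sin (bisectorAngle i u w) * dist u w =
      |(coord j u - coord j w) - (coord l u - coord l w)| / 2 := by
  have hs := coord_add_coord_add_coord h (w - u)
  have h3 : (√3 : ℝ) ^ 2 = 3 := Real.sq_sqrt (by norm_num)
  have hc := cos_bisectorAngle_mul_dist i u w
  have hn : dist u w ^ 2 = _ := dist_sq_eq h.rotate u w
  simp only [coord_sub] at hs
  have hsin : 0 ≤ Real.sin (bisectorAngle i u w) := InnerProductGeometry.sin_angle_nonneg _ _
  rw [← sq_eq_sq₀ (by positivity) (by positivity), mul_pow, Real.sin_sq, sub_mul, ← mul_pow, hc,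
    one_mul, hn, div_pow, sq_abs, mul_pow, div_pow, h3]
  have : coord i w - coord i u = (coord j u - coord j w) + (coord l u - coord l w) := by linarith
  rw [this]; ring

/-- The cosine term is 3/2 of the side and the sine term is half the difference of the distances
from `w` to the two corners. These distances add up to the side, so half a side plus half the
difference is the larger one. -/
theorem positiveBound_eq {i j l : Fin 3} (h : Distinct i j l) (u w : Plane) :
    positiveBound i u w = (coord i w - coord i u) +
      max (coord j u - coord j w) (coord l u - coord l w) := by
  have h3 : (√3 : ℝ) * √3 = 3 := Real.mul_self_sqrt (by norm_num)
  have hs := coord_add_coord_add_coord h (w - u)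
  simp only [coord_sub] at hs
  rw [positiveBound, add_mul, mul_assoc, cos_bisectorAngle_mul_dist, sin_bisectorAngle_mul_dist h]
  rcases le_total (coord j u - coord j w) (coord l u - coord l w) with hle | hle
  · rw [max_eq_right hle, abs_of_nonpos (by linarith)]
    linear_combination (coord i w - coord i u) / 2 * h3 + hs / 2
  · rw [max_eq_left hle, abs_of_nonneg (by linarith)]
    linear_combination (coord i w - coord i u) / 2 * h3 + hs / 2

theorem negativeBound_eq {i j l : Fin 3} (h : Distinct i j l) (u w : Plane) :
    negativeBound i u w = 2 * (coord i w - coord i u) +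
      min (coord j u - coord j w) (coord l u - coord l w) := by
  have h3 : (√3 : ℝ) ≠ 0 := by positivity
  have hs := coord_add_coord_add_coord h (w - u)
  simp only [coord_sub] at hs
  rw [negativeBound, sub_mul, mul_assoc, cos_bisectorAngle_mul_dist, sin_bisectorAngle_mul_dist h]
  have h5 : 5 / √3 * (√3 / 2 * (coord i w - coord i u)) = 5 / 2 * (coord i w - coord i u) := by
    field_simp
  rcases le_total (coord j u - coord j w) (coord l u - coord l w) with hle | hle
  · rw [min_eq_left hle, abs_of_nonpos (by linarith)]
    linear_combination h5 + hs / 2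
  · rw [min_eq_right hle, abs_of_nonneg (by linarith)]
    linear_combination h5 + hs / 2

/-! ### Forwarding rule and potential -/

/-- The triangle with apex `t` and bisector `i` (and `j`, `l` the other two indices) whose side
opposite to `t` contains `s`. -/
def Triangle (i j l : Fin 3) (t s : Plane) : Set Plane :=
  {y | coord i y ≤ coord i s ∧ coord j y ≤ coord j t ∧ coord l y ≤ coord l t}

/-- `s` is in the interior of the positive cone `i` of `t`. -/
def InCone (i j l : Fin 3) (t s : Plane) : Prop :=
  Distinct i j l ∧ coord j s < coord j t ∧ coord l s < coord l t

theorem InCone.swap {i j l : Fin 3} {t s : Plane} (h : InCone i j l t s) : InCone i l j t s :=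
  ⟨h.1.swap, h.2.2, h.2.1⟩

theorem InCone.lt {i j l : Fin 3} {t s : Plane} (h : InCone i j l t s) : coord i t < coord i s := by
  linarith [coord_add_coord_add_coord h.1 t, coord_add_coord_add_coord h.1 s, h.2.1, h.2.2]

theorem InCone.mem {i j l : Fin 3} {t s : Plane} (h : InCone i j l t s) : s ∈ positiveCone i t :=
  (mem_positiveCone h.1).2 ⟨fun e => by simpa [e] using h.2.1, h.2.1.le, h.2.2.le⟩

theorem InCone.not_flip {i j l i' j' l' : Fin 3} {t s : Plane} (h : InCone i j l t s)
    (h' : InCone i' j' l' s t) : False := by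
  have := h.lt
  have := h'.lt
  obtain ⟨hd, hj, hl⟩ := h
  obtain ⟨hd', hj', hl'⟩ := h'
  rcases hd.eq_or j' with rfl | rfl | rfl <;> rcases hd.eq_or l' with rfl | rfl | rfl <;>
    first | linarith | exact hd'.2.2 rfl

theorem InCone.unique {i j l i' j' l' : Fin 3} {t s : Plane} (h : InCone i j l t s)
    (h' : InCone i' j' l' t s) : i' = i ∧ (j' = j ∧ l' = l ∨ j' = l ∧ l' = j) := by
  have := h.lt
  have := h'.lt
  obtain ⟨hd, hj, hl⟩ := h
  obtain ⟨hd', hj', hl'⟩ := h'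
  rcases hd.eq_or i' with rfl | rfl | rfl <;> rcases hd.eq_or j' with rfl | rfl | rfl <;>
    rcases hd.eq_or l' with rfl | rfl | rfl <;> simp_all [Distinct] <;> linarith

/-- The three coordinate differences are nonzero and sum to zero, so one of them differs in sign
from the other two; its index names the cone. -/
theorem exists_inCone_or {t s : Plane} (h : ∀ i, coord i t ≠ coord i s) :
    (∃ i j l, InCone i j l t s) ∨ ∃ i j l, InCone i j l s t := by
  have hd : Distinct 0 1 2 := by decide
  have h1 := coord_add_coord_add_coord hd t
  have h2 := coord_add_coord_add_coord hd s
  rcases lt_or_gt_of_ne (h 0) with h0 | h0 <;> rcases lt_or_gt_of_ne (h 1) with h1 | h1 <;>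
    rcases lt_or_gt_of_ne (h 2) with h2 | h2
  · linarith
  · exact Or.inr ⟨2, 0, 1, by decide, h0, h1⟩
  · exact Or.inr ⟨1, 0, 2, by decide, h0, h2⟩
  · exact Or.inl ⟨0, 1, 2, by decide, h1, h2⟩
  · exact Or.inr ⟨0, 1, 2, by decide, h1, h2⟩
  · exact Or.inl ⟨1, 0, 2, by decide, h0, h2⟩
  · exact Or.inl ⟨2, 0, 1, by decide, h0, h1⟩
  · linarith

/-- The forwarding rule for `t` in a negative cone of `s`, when the part of the cone `l` of `t`
beyond `s` contains no vertex: follow the first edge in angular order from that side. -/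
def HugStep (i j l : Fin 3) (s t : Plane) (N : Set Plane) (v : Plane) : Prop :=
  (∀ y ∈ N, y ∈ Triangle i j l t s → coord l s ≤ coord l y) ∧
  ((∃ y ∈ N, y ∈ Triangle i j l t s ∧ coord j y < coord j s) ∨
    coord l t - coord l s ≤ coord j t - coord j s) ∧
  v ∈ Triangle i j l t s ∧
  ∀ y ∈ N, y ≠ s → y ∈ Triangle i j l t s → coord l v ≤ coord l y

/-- The forwarding rule for `t` in a negative cone of `s`, when there are vertices on
both sides: go to the side of the nearer corner. -/
def CornerStep (i j l : Fin 3) (s t : Plane) (N : Set Plane) (v : Plane) : Prop :=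
  (∃ y ∈ N, y ∈ Triangle i j l t s ∧ coord j y < coord j s) ∧
  v ∈ Triangle i j l t s ∧ coord l v < coord l s ∧
  coord j t - coord j s ≤ coord l t - coord l s

/-- The forwarding rule of the routing algorithm: `v` is a possible next vertex. -/
def Step (s t : Plane) (N : Set Plane) (v : Plane) : Prop :=
  v ∈ N ∧ v ≠ s ∧
    ((∃ i j l, InCone i j l s t ∧ coord j v ≤ coord j s ∧ coord l v ≤ coord l s) ∨
      ∃ i j l, InCone i j l t s ∧ (HugStep i j l s t N v ∨ CornerStep i j l s t N v))

/-- `B` is an upper bound for the potential of `s`, in routing to `t`. -/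
def Potential (P : Finset Plane) (t s : Plane) (B : ℝ) : Prop :=
  (s = t ∧ 0 ≤ B) ∨
  (∃ i j l, InCone i j l s t ∧
    (coord i t - coord i s) + (coord j s - coord j t) ≤ B ∧
    (coord i t - coord i s) + (coord l s - coord l t) ≤ B) ∨
  (∃ i j l, InCone i j l t s ∧ 2 * (coord i s - coord i t) + (coord j t - coord j s) ≤ B) ∨
  (∃ i j l, InCone i j l t s ∧ (∀ y ∈ P, y ∈ Triangle i j l t s → coord l s ≤ coord l y) ∧
    (coord i s - coord i t) + (coord l t - coord l s) ≤ B)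

theorem Potential.nonneg {P : Finset Plane} {t s : Plane} {B : ℝ} (h : Potential P t s B) :
    0 ≤ B := by
  rcases h with ⟨-, h⟩ | ⟨i, j, l, h, h1, h2⟩ | ⟨i, j, l, h, h1⟩ | ⟨i, j, l, h, -, h1⟩
  · exact h
  all_goals linarith [h.lt, h.2.1, h.2.2]

/-! ### Every step pays for its edge -/

section

variable {P : Finset Plane} {s t v : Plane}

/-- A neighbour in a positive cone is the closest vertex in that cone. -/
theorem coord_le_of_adj (hP : GeneralPosition (P : Set Plane)) (hadj : (halfTheta6Graph P).Adj s v)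
    {i j l : Fin 3} (hd : Distinct i j l) (hj : coord j v ≤ coord j s) (hl : coord l v ≤ coord l s)
    {y : Plane} (hy : y ∈ P) (hys : y ≠ s) (hyj : coord j y ≤ coord j s)
    (hyl : coord l y ≤ coord l s) : coord i v ≤ coord i y := by
  rw [generalPosition_iff] at hP
  obtain ⟨hs, hv⟩ := mem_of_adj hadj
  have hne := hP v hv s hs hadj.ne.symm
  have hc : InCone i j l s v := ⟨hd, hj.lt_of_ne (hne j), hl.lt_of_ne (hne l)⟩
  rcases (adj_iff.1 hadj).2 with ⟨i', h⟩ | ⟨i', h⟩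
  · obtain ⟨j', l', hd'⟩ := exists_distinct i'
    rw [isClosest_iff hd'] at h
    have hc' : InCone i' j' l' s v := ⟨hd', h.2.2.2.1.lt_of_ne (hne j'),
      h.2.2.2.2.1.lt_of_ne (hne l')⟩
    obtain ⟨rfl, ⟨rfl, rfl⟩ | ⟨rfl, rfl⟩⟩ := hc.unique hc'
    · exact h.2.2.2.2.2 y hy hys hyj hyl
    · exact h.2.2.2.2.2 y hy hys hyl hyj
  · obtain ⟨j', l', hd'⟩ := exists_distinct i'
    rw [isClosest_iff hd'] at h
    have hc' : InCone i' j' l' v s := ⟨hd', h.2.2.2.1.lt_of_ne (hne j').symm,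
      h.2.2.2.2.1.lt_of_ne (hne l').symm⟩
    exact (hc.not_flip hc').elim

/-- If no vertex of the triangle of `t` and `s` lies beyond `s`, then there is a neighbour of `s`
in it that comes, in angular order, not after a given vertex. -/
theorem exists_adj_coord_le (hP : GeneralPosition (P : Set Plane)) (hs : s ∈ P)
    {i j l : Fin 3} (hc : InCone i j l t s)
    (hempty : ∀ y ∈ P, y ∈ Triangle i j l t s → coord l s ≤ coord l y)
    {x : Plane} (hx : x ∈ P) (hxs : x ≠ s) (hxT : x ∈ Triangle i j l t s) :
    ∃ z, (halfTheta6Graph P).Adj s z ∧ z ∈ Triangle i j l t s ∧ coord l z ≤ coord l x := by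
  classical
  rw [generalPosition_iff] at hP
  -- Extremal choice: among the candidates, the vertex nearest to the side through `s`. Either it
  -- lies in the cone `l` of `s`, whose closest vertex is then a suitable neighbour, or `s` lies in
  -- its cone `i`, where by maximality no other vertex can be closest.
  obtain ⟨y, hy, hmax⟩ := (P.filter fun y => y ≠ s ∧ y ∈ Triangle i j l t s ∧
    coord l y ≤ coord l x).exists_max_image (coord i) ⟨x, by simp [hx, hxs, hxT]⟩
  simp only [Finset.mem_filter] at hy hmax
  obtain ⟨hyP, hys, ⟨hyi, hyj, hyl⟩, hyx⟩ := hy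
  have hly := lt_of_le_of_ne (hempty y hyP ⟨hyi, hyj, hyl⟩) (hP s hs y hyP hys.symm l)
  rcases le_or_gt (coord j y) (coord j s) with hjy | hjy
  · have hd' : Distinct l i j := hc.1.rotate.rotate
    obtain ⟨z, hz⟩ := exists_isClosest hs hyP ((mem_positiveCone hd').2 ⟨hys, hyi, hjy⟩)
    have hadj := hz.adj
    rw [isClosest_iff hd'] at hz
    have := hz.2.2.2.2.2 y hyP hys hyi hjy
    exact ⟨z, hadj, ⟨hz.2.2.2.1, hz.2.2.2.2.1.trans hc.2.1.le, this.trans hyl⟩, this.trans hyx⟩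
  · obtain ⟨z, hz⟩ := exists_isClosest hyP hs ((mem_positiveCone hc.1).2 ⟨hys.symm, hjy.le, hly.le⟩)
    by_cases hzs : z = s
    · subst hzs
      exact ⟨y, hz.adj.symm, ⟨hyi, hyj, hyl⟩, hyx⟩
    · exfalso
      rw [isClosest_iff hc.1] at hz
      obtain ⟨-, hzP, hzy, hzj, hzl, hmin⟩ := hz
      have h1 := hmax z ⟨hzP, hzs, ⟨hmin s hs hys.symm hjy.le hly.le, hzj.trans hyj, hzl.trans hyl⟩,
        hzl.trans hyx⟩
      have := coord_add_coord_add_coord hc.1 z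
      have := coord_add_coord_add_coord hc.1 y
      have := hP z hzP y hyP hzy j
      apply this
      linarith

/-- A side is free of vertices if it is free of neighbours. -/
theorem coord_le_of_neighbourhood (hP : GeneralPosition (P : Set Plane)) (hs : s ∈ P) {i j l : Fin 3} (hc : InCone i j l t s)
    (h : ∀ y ∈ neighbourhood P 1 s, y ∈ Triangle i j l t s → coord l s ≤ coord l y) :
    ∀ y ∈ P, y ∈ Triangle i j l t s → coord l s ≤ coord l y := by
  intro y hy hyT
  by_contra! hlt
  have hys : y ≠ s := by rintro rfl; exact hlt.false
  -- The part of the triangle beyond `s` lies in the cone `j` of `s`. If it contains a vertex, the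
  -- closest vertex of that cone is a neighbour of `s` that also lies in this part.
  have hd' : Distinct j l i := hc.1.rotate
  obtain ⟨z, hz⟩ := exists_isClosest hs hy ((mem_positiveCone hd').2 ⟨hys, hlt.le, hyT.1⟩)
  have hadj := hz.adj
  rw [isClosest_iff hd'] at hz
  obtain ⟨-, hzP, hzs, hzl, hzi, hmin⟩ := hz
  have h1 := h z (mem_neighbourhood_one.2 (Or.inr hadj))
    ⟨hzi, (hmin y hy hys hlt.le hyT.1).trans hyT.2.1, hzl.trans hc.2.2.le⟩
  rw [generalPosition_iff] at hP
  exact hP z hzP s hs hzs l (hzl.antisymm h1)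

theorem mem_triangle_swap {i j l : Fin 3} {y : Plane} :
    y ∈ Triangle i j l t s ↔ y ∈ Triangle i l j t s := by
  simp only [Triangle, Set.mem_ofPred_eq]
  tauto

theorem InCone.mem_triangle {i j l : Fin 3} (hc : InCone i j l t s) : t ∈ Triangle i j l t s :=
  ⟨hc.lt.le, le_rfl, le_rfl⟩

theorem Step.adj (h : Step s t (neighbourhood P 1 s) v) : (halfTheta6Graph P).Adj s v :=
  (mem_neighbourhood_one.1 h.1).resolve_left h.2.1

theorem exists_hugStep (hP : GeneralPosition (P : Set Plane)) (hs : s ∈ P) (ht : t ∈ P)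
    (hst : s ≠ t) {i j l : Fin 3} (hc : InCone i j l t s)
    (h : ∀ y ∈ neighbourhood P 1 s, y ∈ Triangle i j l t s → coord l s ≤ coord l y)
    (h' : (∃ y ∈ neighbourhood P 1 s, y ∈ Triangle i j l t s ∧ coord j y < coord j s) ∨
      coord l t - coord l s ≤ coord j t - coord j s) :
    ∃ v, Step s t (neighbourhood P 1 s) v := by
  classical
  obtain ⟨x, hx, hxT, -⟩ := exists_adj_coord_le hP hs hc (coord_le_of_neighbourhood hP hs hc h)
    ht hst.symm hc.mem_triangle
  obtain ⟨v, hv, hmin⟩ := (P.filter fun y => (halfTheta6Graph P).Adj s y ∧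
    y ∈ Triangle i j l t s).exists_min_image (coord l) ⟨x, by simp [(mem_of_adj hx).2, hx, hxT]⟩
  simp only [Finset.mem_filter] at hv hmin
  refine ⟨v, mem_neighbourhood_one.2 (Or.inr hv.2.1), hv.2.1.ne.symm,
    Or.inr ⟨i, j, l, hc, Or.inl ⟨h, h', hv.2.2, fun y hy hys hyT => ?_⟩⟩⟩
  have hadj := (mem_neighbourhood_one.1 hy).resolve_left hys
  exact hmin y ⟨(mem_of_adj hadj).2, hadj, hyT⟩

/-- With `s` in a cone of `t`: an empty side is hugged, with preference for the nearer corner when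
both are empty; if both sides are occupied, a neighbour on the side of the nearer corner serves.
With `t` in a cone of `s`, that cone is nonempty and has a closest vertex. -/
theorem exists_step (hP : GeneralPosition (P : Set Plane)) (hs : s ∈ P) (ht : t ∈ P)
    (hst : s ≠ t) : ∃ v, Step s t (neighbourhood P 1 s) v := by
  rcases exists_inCone_or (generalPosition_iff.1 hP t ht s hs hst.symm) with
    ⟨i, j, l, hc⟩ | ⟨i, j, l, hc⟩
  · by_cases hl : ∀ y ∈ neighbourhood P 1 s, y ∈ Triangle i j l t s → coord l s ≤ coord l y <;>
    by_cases hj : ∀ y ∈ neighbourhood P 1 s, y ∈ Triangle i j l t s → coord j s ≤ coord j y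
    · rcases le_total (coord l t - coord l s) (coord j t - coord j s) with hle | hle
      · exact exists_hugStep hP hs ht hst hc hl (Or.inr hle)
      · exact exists_hugStep hP hs ht hst hc.swap
          (fun y hy hyT => hj y hy (mem_triangle_swap.1 hyT)) (Or.inr hle)
    · push Not at hj
      exact exists_hugStep hP hs ht hst hc hl (Or.inl hj)
    · push Not at hl
      obtain ⟨y, hy, hyT, h⟩ := hl
      exact exists_hugStep hP hs ht hst hc.swap
          (fun y hy hyT => hj y hy (mem_triangle_swap.1 hyT))
          (Or.inl ⟨y, hy, mem_triangle_swap.1 hyT, h⟩)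
    · push Not at hl hj
      obtain ⟨y, hy, hyT, h⟩ := hl
      obtain ⟨y', hy', hyT', h'⟩ := hj
      rcases le_total (coord j t - coord j s) (coord l t - coord l s) with hle | hle
      · exact ⟨y, hy, fun e => by simp [e] at h, Or.inr ⟨i, j, l, hc,
          Or.inr ⟨⟨y', hy', hyT', h'⟩, hyT, h, hle⟩⟩⟩
      · exact ⟨y', hy', fun e => by simp [e] at h', Or.inr ⟨i, l, j, hc.swap,
          Or.inr ⟨⟨y, hy, mem_triangle_swap.1 hyT, h⟩, mem_triangle_swap.1 hyT', h', hle⟩⟩⟩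
  · obtain ⟨z, hz⟩ := exists_isClosest hs ht hc.mem
    have hadj := hz.adj
    rw [isClosest_iff hc.1] at hz
    exact ⟨z, mem_neighbourhood_one.2 (Or.inr hadj), hz.2.2.1,
      Or.inl ⟨i, j, l, hc, hz.2.2.2.1, hz.2.2.2.2.1⟩⟩

/-- From `s` to `v` the coordinate `i` falls and `l` rises, so the potential drops by exactly the
bound of `dist_le`. The side beyond `v` is still empty: a vertex there would yield, by
`exists_adj_coord_le`, a neighbour of `s` preceding `v` in angular order. -/
theorem HugStep.exists_potential (hP : GeneralPosition (P : Set Plane)) (ht : t ∈ P)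
    {i j l : Fin 3} (hc : InCone i j l t s) (hadj : (halfTheta6Graph P).Adj s v)
    (hv : HugStep i j l s t (neighbourhood P 1 s) v) {B : ℝ}
    (hB : (coord i s - coord i t) + (coord l t - coord l s) ≤ B) :
    ∃ B', Potential P t v B' ∧ B' + dist s v ≤ B := by
  obtain ⟨hsP, hvP⟩ := mem_of_adj hadj
  obtain ⟨h, -, hvT, hmin⟩ := hv
  have hlv := h v (mem_neighbourhood_one.2 (Or.inr hadj)) hvT
  refine ⟨(coord i v - coord i t) + (coord l t - coord l v), ?_, ?_⟩
  · by_cases hvt : v = t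
    · exact Or.inl ⟨hvt, by simp [hvt]⟩
    · have hne := generalPosition_iff.1 hP v hvP t ht hvt
      refine Or.inr (Or.inr (Or.inr ⟨i, j, l, ⟨hc.1, hvT.2.1.lt_of_ne (hne j),
        hvT.2.2.lt_of_ne (hne l)⟩, fun y hy hyT => ?_, le_rfl⟩))
      by_contra! hlt
      have hyT' : y ∈ Triangle i j l t s := ⟨hyT.1.trans hvT.1, hyT.2⟩
      have hys : y ≠ s := by
        rintro rfl
        exact generalPosition_iff.1 hP y hsP v hvP hadj.ne i (hyT.1.antisymm hvT.1)
      obtain ⟨z, hz, hzT, hzl⟩ := exists_adj_coord_le hP hsP hc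
        (coord_le_of_neighbourhood hP hsP hc h) hy hys hyT'
      have := hmin z (mem_neighbourhood_one.2 (Or.inr hz)) hz.ne.symm hzT
      linarith
  · have hd := dist_le hc.1.swap s v
    rw [abs_of_nonneg (by linarith [hvT.1]), abs_of_nonpos (by linarith)] at hd
    linarith

/-- Going to the side of the corner lowers `i` and raises `j`. The potential counts the side twice,
so its drop exceeds the bound of `dist_le` by one further decrease of `coord i`. -/
theorem CornerStep.exists_potential (hP : GeneralPosition (P : Set Plane)) (ht : t ∈ P)
    {i j l : Fin 3} (hc : InCone i j l t s) (hadj : (halfTheta6Graph P).Adj s v)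
    (hv : CornerStep i j l s t (neighbourhood P 1 s) v) {B : ℝ}
    (hB : 2 * (coord i s - coord i t) + (coord j t - coord j s) ≤ B) :
    ∃ B', Potential P t v B' ∧ B' + dist s v ≤ B := by
  obtain ⟨hsP, hvP⟩ := mem_of_adj hadj
  obtain ⟨-, hvT, hlt, -⟩ := hv
  refine ⟨2 * (coord i v - coord i t) + (coord j t - coord j v), ?_, ?_⟩
  · by_cases hvt : v = t
    · exact Or.inl ⟨hvt, by simp [hvt]⟩
    · have hne := generalPosition_iff.1 hP v hvP t ht hvt
      exact Or.inr (Or.inr (Or.inl ⟨i, j, l, ⟨hc.1, hvT.2.1.lt_of_ne (hne j),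
        hvT.2.2.lt_of_ne (hne l)⟩, le_rfl⟩))
  · have hd := dist_le hc.1 s v
    have h1 := hvT.1
    have := coord_add_coord_add_coord hc.1 s
    have := coord_add_coord_add_coord hc.1 v
    rw [abs_of_nonneg (by linarith), abs_of_nonpos (by linarith)] at hd
    linarith

/-- If the next vertex is the closest one in the cone of `t`, and it is in a different
position with respect to `t` than `s` is, then there is nothing on one of its sides. -/
theorem exists_potential_of_lt (hP : GeneralPosition (P : Set Plane))
    {i j l : Fin 3} (hc : InCone i j l s t) (hadj : (halfTheta6Graph P).Adj s v)
    (hj : coord j v ≤ coord j s) (hl : coord l v ≤ coord l s)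
    (hmin : ∀ y ∈ P, y ≠ s → coord j y ≤ coord j s → coord l y ≤ coord l s →
      coord i v ≤ coord i y)
    (hjt : coord j v < coord j t) (hit : coord i v < coord i t) {B : ℝ}
    (hB : (coord i t - coord i s) + (coord l s - coord l t) ≤ B) :
    ∃ B', Potential P t v B' ∧ B' + dist s v ≤ B := by
  obtain ⟨hsP, hvP⟩ := mem_of_adj hadj
  have hne := generalPosition_iff.1 hP v hvP s hsP hadj.ne.symm
  have hcv : InCone i j l s v := ⟨hc.1, hj.lt_of_ne (hne j), hl.lt_of_ne (hne l)⟩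
  -- Now `v` is in the cone `l` of `t`, and the empty side is the one in coordinate `i`: a vertex
  -- there would be in the cone of `s` and closer than `v`.
  refine ⟨(coord l v - coord l t) + (coord i t - coord i v), Or.inr (Or.inr (Or.inr
    ⟨l, j, i, ⟨hc.1.rotate.swap.rotate.rotate, hjt, hit⟩, fun y hy hyT => ?_, le_rfl⟩)), ?_⟩
  · obtain ⟨h1, h2, h3⟩ := hyT
    have := hcv.2.2
    exact hmin y hy (by rintro rfl; linarith) (h2.trans hc.2.1.le) (h1.trans hl)
  · have hd := dist_le hc.1.swap s v
    rw [abs_of_neg (by linarith [hcv.lt]), abs_of_nonneg (by linarith)] at hd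
    linarith

/-- The closest vertex `v` comes before `t` in coordinate `i`. So either `v` is in one of the two
side cones of `t`, and the walk continues in the triangle of `t` with a side known to be empty, or
`t` is still in the cone `i` of `v`. -/
theorem exists_potential_of_inCone (hP : GeneralPosition (P : Set Plane)) (ht : t ∈ P)
    {i j l : Fin 3} (hc : InCone i j l s t) (hadj : (halfTheta6Graph P).Adj s v)
    (hj : coord j v ≤ coord j s) (hl : coord l v ≤ coord l s) {B : ℝ}
    (hBj : (coord i t - coord i s) + (coord j s - coord j t) ≤ B)
    (hBl : (coord i t - coord i s) + (coord l s - coord l t) ≤ B) :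
    ∃ B', Potential P t v B' ∧ B' + dist s v ≤ B := by
  obtain ⟨hsP, hvP⟩ := mem_of_adj hadj
  have hmin := fun y (hy : y ∈ P) => coord_le_of_adj hP hadj hc.1 hj hl hy
  have hne := generalPosition_iff.1 hP v hvP s hsP hadj.ne.symm
  have hcv : InCone i j l s v := ⟨hc.1, hj.lt_of_ne (hne j), hl.lt_of_ne (hne l)⟩
  have hlt := hcv.lt
  have hst : t ≠ s := fun e => by simpa [e] using hc.2.1
  have hdj := dist_le hc.1 s v
  have hdl := dist_le hc.1.swap s v
  rw [abs_of_neg (by linarith), abs_of_nonneg (by linarith)] at hdj hdl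
  by_cases hvt : v = t
  · subst hvt
    exact ⟨0, Or.inl ⟨rfl, le_rfl⟩, by linarith⟩
  · have hne := generalPosition_iff.1 hP v hvP t ht hvt
    have hit := (hmin t ht hst hc.2.1.le hc.2.2.le).lt_of_ne (hne i)
    rcases lt_or_gt_of_ne (hne j) with hjt | hjt
    · exact exists_potential_of_lt hP hc hadj hj hl hmin hjt hit hBl
    rcases lt_or_gt_of_ne (hne l) with hlt' | hlt'
    · exact exists_potential_of_lt hP hc.swap hadj hl hj
        (fun y hy hys hyl hyj => hmin y hy hys hyj hyl) hlt' hit hBj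
    · refine ⟨max ((coord i t - coord i v) + (coord j v - coord j t))
        ((coord i t - coord i v) + (coord l v - coord l t)), Or.inr (Or.inl ⟨i, j, l,
        ⟨hc.1, hjt, hlt'⟩, le_max_left _ _, le_max_right _ _⟩), ?_⟩
      rw [← le_sub_iff_add_le]
      apply max_le <;> linarith

theorem Step.exists_potential (hP : GeneralPosition (P : Set Plane)) (ht : t ∈ P) (hst : s ≠ t)
    (hv : Step s t (neighbourhood P 1 s) v) {B : ℝ} (hB : Potential P t s B) :
    ∃ B', Potential P t v B' ∧ B' + dist s v ≤ B := by
  have hadj := hv.adj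
  obtain ⟨hsP, hvP⟩ := mem_of_adj hadj
  obtain ⟨-, -, ⟨i, j, l, hc, hj, hl⟩ | ⟨i, j, l, hc, hv⟩⟩ := hv
  · rcases hB with ⟨h, -⟩ | ⟨i', j', l', hc', h1, h2⟩ | ⟨i', j', l', hc', -⟩ |
      ⟨i', j', l', hc', -⟩
    · exact (hst h).elim
    · obtain ⟨rfl, ⟨rfl, rfl⟩ | ⟨rfl, rfl⟩⟩ := hc.unique hc'
      · exact exists_potential_of_inCone hP ht hc hadj hj hl h1 h2
      · exact exists_potential_of_inCone hP ht hc hadj hj hl h2 h1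
    · exact (hc.not_flip hc').elim
    · exact (hc.not_flip hc').elim
  · have hs1 := coord_add_coord_add_coord hc.1 s
    have ht1 := coord_add_coord_add_coord hc.1 t
    have hjs := hc.2.1
    have hls := hc.2.2
    have hlt := hc.lt
    rcases hv with hv | hv
    · refine hv.exists_potential hP ht hc hadj ?_
      rcases hB with ⟨h, -⟩ | ⟨i', j', l', hc', -⟩ | ⟨i', j', l', hc', h⟩ |
        ⟨i', j', l', hc', he, h⟩
      · exact (hst h).elim
      · exact (hc.not_flip hc').elim
      -- A side of the triangle is the sum of the distances from `s` to its two corners, so the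
      -- two-sided bound dominates the one-sided bound for either corner.
      · obtain ⟨rfl, ⟨rfl, rfl⟩ | ⟨rfl, rfl⟩⟩ := hc.unique hc' <;> linarith
      · obtain ⟨rfl, ⟨rfl, rfl⟩ | ⟨rfl, rfl⟩⟩ := hc.unique hc'
        · exact h
        -- Here `B` relies on the opposite side being empty. Then the second condition of `HugStep`
        -- must hold through its inequality: the rule heads for the nearer corner.
        · rcases hv.2.1 with ⟨y, hy, hyT, hlt⟩ | hle
          · have := he y ?_ (mem_triangle_swap.1 hyT)
            · exact absurd this (not_le.2 hlt)
            · rcases mem_neighbourhood_one.1 hy with rfl | hy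
              exacts [hsP, (mem_of_adj hy).2]
          · linarith
    · refine hv.exists_potential hP ht hc hadj ?_
      rcases hB with ⟨h, -⟩ | ⟨i', j', l', hc', -⟩ | ⟨i', j', l', hc', h⟩ |
        ⟨i', j', l', hc', he, h⟩
      · exact (hst h).elim
      · exact (hc.not_flip hc').elim
      · have := hv.2.2.2
        obtain ⟨rfl, ⟨rfl, rfl⟩ | ⟨rfl, rfl⟩⟩ := hc.unique hc' <;> linarith
      · obtain ⟨rfl, ⟨rfl, rfl⟩ | ⟨rfl, rfl⟩⟩ := hc.unique hc'
        · exact absurd (he v hvP hv.2.1) (not_le.2 hv.2.2.1)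
        · obtain ⟨y, hy, hyT, hlt⟩ := hv.1
          have := he y ?_ (mem_triangle_swap.1 hyT)
          · exact absurd this (not_le.2 hlt)
          · rcases mem_neighbourhood_one.1 hy with rfl | hy
            exacts [hsP, (mem_of_adj hy).2]

end

/-! ### The algorithm and the upper bounds -/

open scoped Classical in
/-- The routing algorithm that follows the forwarding rule `Step`. -/
noncomputable def stepRouting : LocalRouting 1 where
  -- The choice depends on `s`, `t`, `N` alone, which makes it deterministic and local; the default
  -- `s` never occurs for distinct vertices of a half-Θ₆-graph, by `exists_step`.
  forward s t N := if h : ∃ v, Step s t N v then h.choose else s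
  adj_forward P hP s hs t ht hst := by
    have h := exists_step hP hs ht hst
    rw [dif_pos h]
    exact h.choose_spec.adj

theorem stepRouting_spec {P : Finset Plane} (hP : GeneralPosition (P : Set Plane)) {s t : Plane}
    (hs : s ∈ P) (ht : t ∈ P) (hst : s ≠ t) :
    Step s t (neighbourhood P 1 s) (stepRouting.forward s t (neighbourhood P 1 s)) := by
  have h := exists_step hP hs ht hst
  simp only [stepRouting]
  rw [dif_pos h]
  exact h.choose_spec

namespace LocalRouting

variable {k : ℕ} (A : LocalRouting k) {P : Finset Plane} {s t : Plane}

theorem route_self (n : ℕ) : A.route P t t n = t := by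
  induction n with
  | zero => rfl
  | succ n ih => rw [route, if_pos ih]

theorem route_succ_of_ne (hst : s ≠ t) (n : ℕ) :
    A.route P s t (n + 1) = A.route P (A.forward s t (neighbourhood P k s)) t n := by
  induction n with
  | zero => simp [route, hst]
  | succ n ih => rw [route, ih, route]

theorem routeLength_of_ne (hst : s ≠ t) :
    A.routeLength P s t = edist s (A.forward s t (neighbourhood P k s)) +
      A.routeLength P (A.forward s t (neighbourhood P k s)) t := by
  rw [routeLength, tsum_eq_zero_add' ENNReal.summable]
  simp only [A.route_succ_of_ne hst, routeLength]
  rfl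

end LocalRouting

/-- The points of a finite set have a positive least distance. -/
theorem exists_pos_le_dist (P : Finset Plane) :
    ∃ δ : ℝ, 0 < δ ∧ ∀ u ∈ P, ∀ v ∈ P, u ≠ v → δ ≤ dist u v := by
  classical
  rcases P.offDiag.eq_empty_or_nonempty with h | h
  · refine ⟨1, one_pos, fun u hu v hv hne => ?_⟩
    have : (u, v) ∈ P.offDiag := Finset.mem_offDiag.2 ⟨hu, hv, hne⟩
    simp [h] at this
  · obtain ⟨x, hx, hmin⟩ := P.offDiag.exists_min_image (fun x => dist x.1 x.2) h
    exact ⟨dist x.1 x.2, dist_pos.2 (Finset.mem_offDiag.1 hx).2.2, fun u hu v hv hne =>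
      hmin (u, v) (Finset.mem_offDiag.2 ⟨hu, hv, hne⟩)⟩

/-- Potential descent: each step costs at least the minimal distance `δ` and at most the loss of
potential, so fewer than `n` steps suffice once `B < n * δ`. The walk in the conclusion serves the
spanning ratio. -/
theorem stepRouting_of_potential {P : Finset Plane} (hP : GeneralPosition (P : Set Plane))
    {s t : Plane} (hs : s ∈ P) (ht : t ∈ P) {B : ℝ} (hB : Potential P t s B) :
    stepRouting.Delivers P s t ∧ stepRouting.routeLength P s t ≤ ENNReal.ofReal B ∧
      ∃ p : (halfTheta6Graph P).Walk s t, (p.darts.map fun e => dist e.fst e.snd).sum ≤ B := by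
  obtain ⟨δ, hδ, hmin⟩ := exists_pos_le_dist P
  obtain ⟨n, hn⟩ := exists_nat_gt (B / δ)
  rw [div_lt_iff₀ hδ] at hn
  induction n generalizing s B with
  | zero => simp only [Nat.cast_zero, zero_mul] at hn; exact absurd hB.nonneg (not_le.2 hn)
  | succ n ih =>
    by_cases hst : s = t
    · subst hst
      refine ⟨⟨0, rfl⟩, ?_, SimpleGraph.Walk.nil, by simpa using hB.nonneg⟩
      simp [LocalRouting.routeLength, LocalRouting.route_self]
    have hstep := stepRouting_spec hP hs ht hst
    have hadj := hstep.adj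
    obtain ⟨B', hB', hle⟩ := hstep.exists_potential hP ht hst hB
    have hv := (mem_of_adj hadj).2
    have hδ' := hmin _ hs _ hv hadj.ne
    push_cast at hn
    obtain ⟨⟨m, hm⟩, hlen, p, hp⟩ := ih hv hB' (by linarith)
    refine ⟨⟨m + 1, by rw [LocalRouting.route_succ_of_ne _ hst, hm]⟩, ?_,
      SimpleGraph.Walk.cons hadj p, ?_⟩
    · rw [LocalRouting.routeLength_of_ne _ hst, edist_dist]
      calc _ ≤ ENNReal.ofReal _ + ENNReal.ofReal B' := by gcongr
        _ = ENNReal.ofReal (_ + B') := (ENNReal.ofReal_add dist_nonneg hB'.nonneg).symm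
        _ ≤ _ := ENNReal.ofReal_le_ofReal (by linarith)
    · simp only [SimpleGraph.Walk.darts_cons, List.map_cons, List.sum_cons]
      linarith

section

variable {P : Finset Plane} {i : Fin 3} {u w : Plane}

theorem exists_inCone_of_mem {S : Set Plane} (hP : GeneralPosition S) (hu : u ∈ S) (hw : w ∈ S)
    (h : w ∈ positiveCone i u) : ∃ j l, InCone i j l u w := by
  obtain ⟨j, l, hd⟩ := exists_distinct i
  obtain ⟨hne, hj, hl⟩ := (mem_positiveCone hd).1 h
  have hne' := generalPosition_iff.1 hP w hw u hu hne
  exact ⟨j, l, hd, hj.lt_of_ne (hne' j), hl.lt_of_ne (hne' l)⟩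

theorem potential_positiveBound (hP : GeneralPosition (P : Set Plane)) (hu : u ∈ P) (hw : w ∈ P)
    (h : w ∈ positiveCone i u) : Potential P w u (positiveBound i u w) := by
  obtain ⟨j, l, hc⟩ := exists_inCone_of_mem hP hu hw h
  rw [positiveBound_eq hc.1]
  exact Or.inr (Or.inl ⟨i, j, l, hc, by gcongr; exact le_max_left _ _,
    by gcongr; exact le_max_right _ _⟩)

theorem potential_negativeBound (hP : GeneralPosition (P : Set Plane)) (hu : u ∈ P) (hw : w ∈ P)
    (h : w ∈ positiveCone i u) : Potential P u w (negativeBound i u w) := by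
  obtain ⟨j, l, hc⟩ := exists_inCone_of_mem hP hu hw h
  rw [negativeBound_eq hc.1]
  rcases min_choice (coord j u - coord j w) (coord l u - coord l w) with h | h <;> rw [h]
  · exact Or.inr (Or.inr (Or.inl ⟨i, j, l, hc, le_rfl⟩))
  · exact Or.inr (Or.inr (Or.inl ⟨i, l, j, hc.swap, le_rfl⟩))

theorem positiveBound_le : positiveBound i u w ≤ 2 * dist u w := by
  have h3 : (√3 : ℝ) ^ 2 = 3 := Real.sq_sqrt (by norm_num)
  have := Real.sin_sq_add_cos_sq (bisectorAngle i u w)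
  refine mul_le_mul_of_nonneg_right ?_ dist_nonneg
  nlinarith [sq_nonneg (√3 * Real.sin (bisectorAngle i u w) - Real.cos (bisectorAngle i u w)),
    sq_nonneg (√3 * Real.cos (bisectorAngle i u w) + Real.sin (bisectorAngle i u w) - 2)]

theorem negativeBound_le : negativeBound i u w ≤ 5 / √3 * dist u w := by
  refine mul_le_mul_of_nonneg_right ?_ dist_nonneg
  have h1 : 0 ≤ Real.sin (bisectorAngle i u w) := InnerProductGeometry.sin_angle_nonneg _ _
  have h2 : 5 / √3 * Real.cos (bisectorAngle i u w) ≤ 5 / √3 * 1 :=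
    mul_le_mul_of_nonneg_left (Real.cos_le_one _) (by positivity)
  linarith

end

theorem two_le_five_div_sqrt_three : 2 ≤ 5 / √3 := by
  have h3 : (√3 : ℝ) ^ 2 = 3 := Real.sq_sqrt (by norm_num)
  rw [le_div_iff₀ (by positivity)]
  nlinarith [Real.sqrt_nonneg 3]

theorem isCompetitive_stepRouting : stepRouting.IsCompetitive (5 / √3) := by
  intro P hP s hs t ht
  by_cases hst : s = t
  · subst hst
    exact ⟨⟨0, rfl⟩, by simp [LocalRouting.routeLength, LocalRouting.route_self]⟩
  rcases exists_inCone_or (generalPosition_iff.1 hP t ht s hs (Ne.symm hst)) with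
    ⟨i, j, l, hc⟩ | ⟨i, j, l, hc⟩
  · obtain ⟨h1, h2, -⟩ := stepRouting_of_potential hP hs ht (potential_negativeBound hP ht hs hc.mem)
    refine ⟨h1, h2.trans (ENNReal.ofReal_le_ofReal ?_)⟩
    rw [dist_comm]
    exact negativeBound_le
  · obtain ⟨h1, h2, -⟩ := stepRouting_of_potential hP hs ht (potential_positiveBound hP hs ht hc.mem)
    refine ⟨h1, h2.trans (ENNReal.ofReal_le_ofReal ?_)⟩
    refine positiveBound_le.trans ?_
    gcongr
    exact two_le_five_div_sqrt_three

theorem isSpanner_two : IsSpanner 2 := by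
  have key : ∀ P : Finset Plane, GeneralPosition (P : Set Plane) → ∀ u ∈ P, ∀ w ∈ P, ∀ i j l,
      InCone i j l u w → ∃ p : (halfTheta6Graph P).Walk u w,
        (p.darts.map fun e => dist e.fst e.snd).sum ≤ 2 * dist u w := by
    intro P hP u hu w hw i j l hc
    obtain ⟨-, -, p, hp⟩ :=
      stepRouting_of_potential hP hu hw (potential_positiveBound hP hu hw hc.mem)
    exact ⟨p, hp.trans positiveBound_le⟩
  intro P hP s hs t ht
  by_cases hst : s = t
  · subst hst
    exact ⟨SimpleGraph.Walk.nil, by simp⟩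
  rcases exists_inCone_or (generalPosition_iff.1 hP t ht s hs (Ne.symm hst)) with
    ⟨i, j, l, hc⟩ | ⟨i, j, l, hc⟩
  · obtain ⟨p, hp⟩ := key P hP t ht s hs i j l hc
    refine ⟨p.reverse, ?_⟩
    rw [dist_comm s t]
    refine le_of_eq_of_le ?_ hp
    rw [SimpleGraph.Walk.darts_reverse, List.map_reverse, List.sum_reverse, List.map_map]
    congr 1
    refine List.map_congr_left fun e _ => ?_
    simp [dist_comm]
  · exact key P hP s hs t ht i j l hc

/-! ### Zigzags and their graphs -/

/-- The points `c 0`, `c 1`, ... in the positive cone `i` of `u` descend towards `u`; those with odd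
index are close to one corner of the canonical triangle of `u` and `c 0`, those
with even index to the other one. -/
structure Zigzag (i j l : Fin 3) (u : Plane) (c : ℕ → Plane) (M : ℕ) : Prop where
  distinct : Distinct i j l
  anti : ∀ a b, a < b → b ≤ M → coord i (c b) < coord i (c a)
  apex_i : ∀ a ≤ M, coord i u < coord i (c a)
  apex_j : ∀ a ≤ M, coord j (c a) < coord j u
  apex_l : ∀ a ≤ M, coord l (c a) < coord l u
  odd_j : ∀ a ≤ M, a % 2 = 1 → coord j (c 0) < coord j (c a)
  odd_l : ∀ a ≤ M, a % 2 = 1 → coord l (c a) < coord l (c 0)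
  even_j : ∀ a ≤ M, 0 < a → a % 2 = 0 → coord j (c a) < coord j (c 0)
  even_l : ∀ a ≤ M, 0 < a → a % 2 = 0 → coord l (c 0) < coord l (c a)
  mono_j : ∀ a b, 0 < a → a < b → b ≤ M → a % 2 = b % 2 → coord j (c a) < coord j (c b)
  mono_l : ∀ a b, 0 < a → a < b → b ≤ M → a % 2 = b % 2 → coord l (c a) < coord l (c b)

open scoped Classical in
/-- The vertex set consisting of `u` and the first points of a zigzag. -/
noncomputable def zigzagSet (u : Plane) (c : ℕ → Plane) (m : ℕ) : Finset Plane :=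
  insert u ((Finset.range (m + 1)).image c)

theorem mem_zigzagSet {u : Plane} {c : ℕ → Plane} {m : ℕ} {x : Plane} :
    x ∈ zigzagSet u c m ↔ x = u ∨ ∃ a ≤ m, x = c a := by
  simp [zigzagSet, eq_comm]

theorem apex_mem_zigzagSet {u : Plane} {c : ℕ → Plane} {m : ℕ} : u ∈ zigzagSet u c m :=
  mem_zigzagSet.2 (Or.inl rfl)

theorem point_mem_zigzagSet {u : Plane} {c : ℕ → Plane} {m a : ℕ} (h : a ≤ m) :
    c a ∈ zigzagSet u c m :=
  mem_zigzagSet.2 (Or.inr ⟨a, h, rfl⟩)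

namespace Zigzag

variable {i j l : Fin 3} {u : Plane} {c : ℕ → Plane} {M m a b : ℕ}

theorem eq_of_eq (h : Zigzag i j l u c M) (ha : a ≤ M) (hb : b ≤ M) (he : c a = c b) : a = b := by
  rcases lt_trichotomy a b with hab | hab | hab
  · have := h.anti a b hab hb
    simp [he] at this
  · exact hab
  · have := h.anti b a hab ha
    simp [he] at this

theorem ne_apex (h : Zigzag i j l u c M) (ha : a ≤ M) : c a ≠ u :=
  fun e => by simpa [e] using h.apex_i a ha

theorem coord_ne (h : Zigzag i j l u c M) (hab : a < b) (hb : b ≤ M) (x : Fin 3) :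
    coord x (c a) ≠ coord x (c b) := by
  obtain rfl | ha0 := Nat.eq_zero_or_pos a
  · rcases h.distinct.eq_or x with rfl | rfl | rfl
    · exact (h.anti 0 b hab hb).ne'
    · rcases Nat.mod_two_eq_zero_or_one b with hb2 | hb2
      exacts [(h.even_j b hb hab hb2).ne', (h.odd_j b hb hb2).ne]
    · rcases Nat.mod_two_eq_zero_or_one b with hb2 | hb2
      exacts [(h.even_l b hb hab hb2).ne, (h.odd_l b hb hb2).ne']
  have ha : a ≤ M := hab.le.trans hb
  have hb0 : 0 < b := ha0.trans hab
  rcases h.distinct.eq_or x with rfl | rfl | rfl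
  · exact (h.anti a b hab hb).ne'
  · rcases Nat.mod_two_eq_zero_or_one a with ha2 | ha2 <;>
      rcases Nat.mod_two_eq_zero_or_one b with hb2 | hb2
    · exact (h.mono_j a b ha0 hab hb (by omega)).ne
    · exact ((h.even_j a ha ha0 ha2).trans (h.odd_j b hb hb2)).ne
    · exact ((h.even_j b hb hb0 hb2).trans (h.odd_j a ha ha2)).ne'
    · exact (h.mono_j a b ha0 hab hb (by omega)).ne
  · rcases Nat.mod_two_eq_zero_or_one a with ha2 | ha2 <;>
      rcases Nat.mod_two_eq_zero_or_one b with hb2 | hb2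
    · exact (h.mono_l a b ha0 hab hb (by omega)).ne
    · exact ((h.odd_l b hb hb2).trans (h.even_l a ha ha0 ha2)).ne'
    · exact ((h.odd_l a ha ha2).trans (h.even_l b hb hb0 hb2)).ne
    · exact (h.mono_l a b ha0 hab hb (by omega)).ne

theorem apex_ne (h : Zigzag i j l u c M) (ha : a ≤ M) (x : Fin 3) :
    coord x u ≠ coord x (c a) := by
  rcases h.distinct.eq_or x with rfl | rfl | rfl
  exacts [(h.apex_i a ha).ne, (h.apex_j a ha).ne', (h.apex_l a ha).ne']

theorem generalPosition (h : Zigzag i j l u c M) (hm : m ≤ M) :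
    GeneralPosition (zigzagSet u c m : Set Plane) := by
  rw [generalPosition_iff]
  intro x hx y hy hne z
  rw [Finset.mem_coe, mem_zigzagSet] at hx hy
  rcases hx with rfl | ⟨a, ha, rfl⟩ <;> rcases hy with rfl | ⟨b, hb, rfl⟩
  · exact (hne rfl).elim
  · exact h.apex_ne (hb.trans hm) z
  · exact (h.apex_ne (ha.trans hm) z).symm
  · rcases lt_trichotomy a b with hab | rfl | hab
    · exact h.coord_ne hab (hb.trans hm) z
    · exact (hne rfl).elim
    · exact (h.coord_ne hab (ha.trans hm) z).symm

/-- This and the next two lemmas determine all possible edges among the `c a`: the cone `i` looks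
back along the same corner, while the cones `j` and `l` look ahead to the opposite corner, with `c
0` looking ahead to both. -/
theorem of_cone_i (h : Zigzag i j l u c M) (ha : a ≤ M) (hb : b ≤ M) (hne : b ≠ a)
    (hj : coord j (c b) ≤ coord j (c a)) (hl : coord l (c b) ≤ coord l (c a)) :
    0 < b ∧ b < a ∧ b % 2 = a % 2 := by
  have hba : b < a := by
    by_contra! hle
    have := h.anti a b (by omega) hb
    linarith [coord_add_coord_add_coord h.distinct (c a),
      coord_add_coord_add_coord h.distinct (c b)]
  have hb0 : 0 < b := by
    by_contra! hb0
    obtain rfl : b = 0 := by omega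
    rcases Nat.mod_two_eq_zero_or_one a with ha2 | ha2
    · exact hj.not_gt (h.even_j a ha hba ha2)
    · exact hl.not_gt (h.odd_l a ha ha2)
  refine ⟨hb0, hba, ?_⟩
  rcases Nat.mod_two_eq_zero_or_one a with ha2 | ha2 <;>
    rcases Nat.mod_two_eq_zero_or_one b with hb2 | hb2
  · omega
  · exact absurd hj ((h.even_j a ha (by omega) ha2).trans (h.odd_j b hb hb2)).not_ge
  · exact absurd hl ((h.odd_l a ha ha2).trans (h.even_l b hb hb0 hb2)).not_ge
  · omega

theorem of_cone_j (h : Zigzag i j l u c M) (ha : a ≤ M) (hb : b ≤ M) (hne : b ≠ a)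
    (hl : coord l (c b) ≤ coord l (c a)) (hi : coord i (c b) ≤ coord i (c a)) :
    a < b ∧ b % 2 = 1 ∧ a % 2 = 0 := by
  have hab : a < b := by
    by_contra! hle
    exact hi.not_gt (h.anti b a (by omega) ha)
  rcases Nat.mod_two_eq_zero_or_one a with ha2 | ha2 <;>
    rcases Nat.mod_two_eq_zero_or_one b with hb2 | hb2
  · obtain rfl | ha0 := Nat.eq_zero_or_pos a
    · exact absurd hl (h.even_l b hb hab hb2).not_ge
    · exact absurd hl (h.mono_l a b ha0 hab hb (by omega)).not_ge
  · exact ⟨hab, hb2, ha2⟩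
  · exact absurd hl ((h.odd_l a ha ha2).trans (h.even_l b hb (by omega) hb2)).not_ge
  · exact absurd hl (h.mono_l a b (by omega) hab hb (by omega)).not_ge

theorem of_cone_l (h : Zigzag i j l u c M) (ha : a ≤ M) (hb : b ≤ M) (hne : b ≠ a)
    (hi : coord i (c b) ≤ coord i (c a)) (hj : coord j (c b) ≤ coord j (c a)) :
    a < b ∧ b % 2 = 0 ∧ (a = 0 ∨ a % 2 = 1) := by
  have hab : a < b := by
    by_contra! hle
    exact hi.not_gt (h.anti b a (by omega) ha)
  rcases Nat.mod_two_eq_zero_or_one a with ha2 | ha2 <;>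
    rcases Nat.mod_two_eq_zero_or_one b with hb2 | hb2
  · obtain rfl | ha0 := Nat.eq_zero_or_pos a
    · exact ⟨hab, hb2, Or.inl rfl⟩
    · exact absurd hj (h.mono_j a b ha0 hab hb (by omega)).not_ge
  · obtain rfl | ha0 := Nat.eq_zero_or_pos a
    · exact absurd hj (h.odd_j b hb hb2).not_ge
    · exact absurd hj ((h.even_j a ha ha0 ha2).trans (h.odd_j b hb hb2)).not_ge
  · exact ⟨hab, hb2, Or.inr ha2⟩
  · exact absurd hj (h.mono_j a b (by omega) hab hb (by omega)).not_ge

/-- A longer edge would pass over a closer vertex of the same cone: `c (a - 2)` looking back, `c (a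
+ 1)` looking ahead, or `c 2` from `c 0` in the cone `l`. -/
theorem le_add_two_of_isClosest (h : Zigzag i j l u c M) (hm : m ≤ M) (ha : a ≤ m) (hb : b ≤ m)
    {x : Fin 3} (hx : IsClosest (zigzagSet u c m) x (c a) (c b)) : b ≤ a + 2 ∧ a ≤ b + 2 := by
  have hne : b ≠ a := fun e => hx.ne (congrArg c e)
  have hne' {d : ℕ} (hd : d ≤ M) (hda : d ≠ a) : c d ≠ c a := fun e =>
    hda (h.eq_of_eq hd (by omega) e)
  rcases h.distinct.eq_or x with rfl | rfl | rfl
  · obtain ⟨-, -, -, hj, hl, hmin⟩ := (isClosest_iff h.distinct).1 hx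
    obtain ⟨h0, hlt, hmod⟩ := h.of_cone_i (ha.trans hm) (hb.trans hm) hne hj hl
    refine ⟨by omega, ?_⟩
    by_contra! hcon
    have := hmin (c (a - 2)) (point_mem_zigzagSet (by omega)) (hne' (by omega) (by omega))
      (h.mono_j _ _ (by omega) (by omega) (by omega) (by omega)).le
      (h.mono_l _ _ (by omega) (by omega) (by omega) (by omega)).le
    exact this.not_gt (h.anti b (a - 2) (by omega) (by omega))
  · obtain ⟨-, -, -, hl, hi, hmin⟩ := (isClosest_iff h.distinct.rotate).1 hx
    obtain ⟨hlt, hb2, ha2⟩ := h.of_cone_j (ha.trans hm) (hb.trans hm) hne hl hi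
    refine ⟨?_, by omega⟩
    by_contra! hcon
    have hle : coord l (c (a + 1)) ≤ coord l (c a) := by
      have h1 := h.odd_l (a + 1) (by omega) (by omega)
      obtain rfl | ha0 := Nat.eq_zero_or_pos a
      · exact h1.le
      · exact (h1.trans (h.even_l a (by omega) ha0 ha2)).le
    have := hmin (c (a + 1)) (point_mem_zigzagSet (by omega)) (hne' (by omega) (by omega)) hle
      (h.anti a (a + 1) (by omega) (by omega)).le
    exact this.not_gt (h.mono_j (a + 1) b (by omega) (by omega) (by omega) (by omega))
  · obtain ⟨-, -, -, hi, hj, hmin⟩ := (isClosest_iff h.distinct.rotate.rotate).1 hx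
    obtain ⟨hlt, hb2, ha2⟩ := h.of_cone_l (ha.trans hm) (hb.trans hm) hne hi hj
    refine ⟨?_, by omega⟩
    by_contra! hcon
    rcases ha2 with rfl | ha2
    · have := hmin (c 2) (point_mem_zigzagSet (by omega)) (hne' (by omega) (by omega))
        (h.anti 0 2 (by omega) (by omega)).le (h.even_j 2 (by omega) (by omega) (by omega)).le
      exact this.not_gt (h.mono_l 2 b (by omega) (by omega) (by omega) (by omega))
    · have := hmin (c (a + 1)) (point_mem_zigzagSet (by omega)) (hne' (by omega) (by omega))
        (h.anti a (a + 1) (by omega) (by omega)).le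
        ((h.even_j (a + 1) (by omega) (by omega) (by omega)).trans (h.odd_j a (by omega) ha2)).le
      exact this.not_gt (h.mono_l (a + 1) b (by omega) (by omega) (by omega) (by omega))

theorem eq_of_adj_apex (h : Zigzag i j l u c M) (hm : m ≤ M) {v : Plane}
    (hv : (halfTheta6Graph (zigzagSet u c m)).Adj u v) : v = c m := by
  obtain ⟨b, hb, rfl⟩ : ∃ b ≤ m, v = c b :=
    (mem_zigzagSet.1 (mem_of_adj hv).2).resolve_left hv.ne.symm
  have hi := h.apex_i b (hb.trans hm)
  have hj := h.apex_j b (hb.trans hm)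
  have hl := h.apex_l b (hb.trans hm)
  rcases (adj_iff.1 hv).2 with ⟨x, hx⟩ | ⟨x, hx⟩ <;> rcases h.distinct.eq_or x with rfl | rfl | rfl
  · obtain ⟨-, -, -, -, -, hmin⟩ := (isClosest_iff h.distinct).1 hx
    have := hmin (c m) (point_mem_zigzagSet le_rfl) (h.ne_apex hm) (h.apex_j m hm).le
      (h.apex_l m hm).le
    obtain hb | rfl := hb.lt_or_eq
    · exact absurd this (h.anti b m hb hm).not_ge
    · rfl
  · exact absurd ((isClosest_iff h.distinct.rotate).1 hx).2.2.2.2.1 hi.not_ge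
  · exact absurd ((isClosest_iff h.distinct.rotate.rotate).1 hx).2.2.2.1 hi.not_ge
  · exact absurd ((isClosest_iff h.distinct).1 hx).2.2.2.1 hj.not_ge
  · exact absurd ((isClosest_iff h.distinct.rotate).1 hx).2.2.2.1 hl.not_ge
  · exact absurd ((isClosest_iff h.distinct.rotate.rotate).1 hx).2.2.2.2.1 hj.not_ge

theorem adj_zero_one (h : Zigzag i j l u c M) (hm : m ≤ M) (h1 : 1 ≤ m) :
    (halfTheta6Graph (zigzagSet u c m)).Adj (c 0) (c 1) := by
  have hc : IsClosest (zigzagSet u c m) j (c 0) (c 1) := by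
    rw [isClosest_iff h.distinct.rotate]
    refine ⟨point_mem_zigzagSet (by omega), point_mem_zigzagSet h1, fun e => ?_,
      (h.odd_l 1 (by omega) rfl).le, (h.anti 0 1 (by omega) (by omega)).le, fun x hx hne hl hi => ?_⟩
    · exact absurd (h.eq_of_eq (by omega) (by omega) e) (by omega)
    · rcases mem_zigzagSet.1 hx with rfl | ⟨b, hb, rfl⟩
      · exact absurd hl (h.apex_l 0 (by omega)).not_ge
      · obtain ⟨h0, hb2, -⟩ := h.of_cone_j (Nat.zero_le _) (hb.trans hm)
          (fun e => hne (congrArg c e)) hl hi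
        obtain hb1 | rfl := (Nat.succ_le_of_lt h0).lt_or_eq
        · exact (h.mono_j 1 b (by omega) hb1 (by omega) (by omega)).le
        · rfl
  exact hc.adj

theorem adj_add_two (h : Zigzag i j l u c M) (hm : m ≤ M) (ha : a + 2 ≤ m) :
    (halfTheta6Graph (zigzagSet u c m)).Adj (c a) (c (a + 2)) := by
  obtain rfl | ha0 := Nat.eq_zero_or_pos a
  · have hc : IsClosest (zigzagSet u c m) l (c 0) (c 2) := by
      rw [isClosest_iff h.distinct.rotate.rotate]
      refine ⟨point_mem_zigzagSet (by omega), point_mem_zigzagSet (by omega), fun e => ?_,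
        (h.anti 0 2 (by omega) (by omega)).le, (h.even_j 2 (by omega) (by omega) rfl).le,
        fun x hx hne hi hj => ?_⟩
      · exact absurd (h.eq_of_eq (by omega) (by omega) e) (by omega)
      · rcases mem_zigzagSet.1 hx with rfl | ⟨b, hb, rfl⟩
        · exact absurd hj (h.apex_j 0 (by omega)).not_ge
        · obtain ⟨h0, hb2, -⟩ := h.of_cone_l (Nat.zero_le _) (hb.trans hm)
            (fun e => hne (congrArg c e)) hi hj
          obtain hb1 | rfl := (show 2 ≤ b by omega).lt_or_eq
          · exact (h.mono_l 2 b (by omega) hb1 (by omega) (by omega)).le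
          · rfl
    exact hc.adj
  · have hc : IsClosest (zigzagSet u c m) i (c (a + 2)) (c a) := by
      rw [isClosest_iff h.distinct]
      refine ⟨point_mem_zigzagSet (by omega), point_mem_zigzagSet (by omega), fun e => ?_,
        (h.mono_j a (a + 2) ha0 (by omega) (by omega) (by omega)).le,
        (h.mono_l a (a + 2) ha0 (by omega) (by omega) (by omega)).le, fun x hx hne hj hl => ?_⟩
      · exact absurd (h.eq_of_eq (by omega) (by omega) e) (by omega)
      · rcases mem_zigzagSet.1 hx with rfl | ⟨b, hb, rfl⟩
        · exact absurd hj (h.apex_j (a + 2) (by omega)).not_ge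
        · obtain ⟨h0, hb1, hb2⟩ := h.of_cone_i (by omega) (hb.trans hm)
            (fun e => hne (congrArg c e)) hj hl
          obtain hb1 | rfl := (show b ≤ a by omega).lt_or_eq
          · exact (h.anti b a (by omega) (by omega)).le
          · rfl
    exact hc.adj.symm

/-- An edge raises the index by at most two, and `u` can only be entered from `c m`, so a walk too
short to reach index `m` never meets `u`. -/
theorem exists_eq_of_walk (h : Zigzag i j l u c M) (hm : m ≤ M) {x v : Plane}
    (p : (halfTheta6Graph (zigzagSet u c m)).Walk x v) :
    ∀ a, x = c a → a + 2 * p.length < m → ∃ b ≤ a + 2 * p.length, v = c b := by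
  induction p with
  | nil => exact fun a hx _ => ⟨a, by omega, hx⟩
  | @cons x y v hxy p ih =>
    rintro a rfl hlt
    simp only [SimpleGraph.Walk.length_cons] at hlt ⊢
    rcases mem_zigzagSet.1 (mem_of_adj hxy).2 with rfl | ⟨b, hb, rfl⟩
    · have := h.eq_of_eq (by omega) hm (h.eq_of_adj_apex hm hxy.symm)
      omega
    · have hab : b ≤ a + 2 := by
        rcases (adj_iff.1 hxy).2 with ⟨x, hx⟩ | ⟨x, hx⟩
        · exact (h.le_add_two_of_isClosest hm (by omega) hb hx).1
        · exact (h.le_add_two_of_isClosest hm hb (by omega) hx).2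
      obtain ⟨d, hd, hv⟩ := ih b rfl (by omega)
      exact ⟨d, by omega, hv⟩

/-- The right side does not depend on `m`: from `c 0`, zigzags of different lengths beyond `2 * k`
look the same. -/
theorem neighbourhood_eq (h : Zigzag i j l u c M) (hm : m ≤ M) {k : ℕ} (hk : 2 * k < m) :
    neighbourhood (zigzagSet u c m) k (c 0) = c '' {b | b ≤ 2 * k} := by
  ext v
  constructor
  · rintro ⟨p, hp⟩
    obtain ⟨b, hb, hv⟩ := h.exists_eq_of_walk hm p 0 rfl (by omega)
    exact ⟨b, show b ≤ 2 * k by omega, hv.symm⟩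
  · rintro ⟨b, hb, rfl⟩
    have hb : b ≤ 2 * k := hb
    induction k generalizing b with
    | zero =>
      obtain rfl : b = 0 := by omega
      exact ⟨SimpleGraph.Walk.nil, by simp⟩
    | succ k ih =>
      by_cases hbk : b ≤ 2 * k
      · obtain ⟨p, hp⟩ := ih (by omega) b hbk hbk
        exact ⟨p, by omega⟩
      by_cases hb1 : b = 1
      · subst hb1
        exact ⟨(h.adj_zero_one hm (by omega)).toWalk, by simp⟩
      · obtain ⟨b, rfl⟩ : ∃ d, b = d + 2 := ⟨b - 2, by omega⟩
        obtain ⟨p, hp⟩ := ih (by omega) b (show b ≤ 2 * k by omega) (by omega)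
        exact ⟨p.concat (h.adj_add_two hm (by omega)), by simpa using hp⟩

end Zigzag

/-! ### Construction of zigzags -/

theorem dist_eq_of_coord_eq {i j l : Fin 3} (h : Distinct i j l) {u v : Plane}
    (hi : coord i u = coord i v) : dist u v = |coord j u - coord j v| := by
  rw [← abs_of_nonneg (dist_nonneg (x := u) (y := v)), ← sq_eq_sq_iff_abs_eq_abs, dist_sq_eq h, hi]
  ring

/-- In each canonical triangle there are zigzags of any length arbitrarily near to its corners. -/
theorem exists_zigzag {i j l : Fin 3} {u w : Plane} (hc : InCone i j l u w) (M : ℕ) {ε : ℝ}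
    (hε : 0 < ε) : ∃ (c : ℕ → Plane) (x y : Plane), Zigzag i j l u c M ∧ c 0 = w ∧
      dist u x = coord i w - coord i u ∧ dist u y = coord i w - coord i u ∧
      dist x y = coord i w - coord i u ∧
      dist w x = coord j u - coord j w ∧ dist w y = coord l u - coord l w ∧
      ∀ n ≤ M, (n % 2 = 1 → dist (c n) x ≤ ε) ∧ (0 < n → n % 2 = 0 → dist (c n) y ≤ ε) := by
  obtain ⟨hd, hj, hl⟩ := id hc
  have hi := hc.lt
  have hu := coord_add_coord_add_coord hd u
  have hw := coord_add_coord_add_coord hd w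
  obtain ⟨x, hxi, hxj⟩ := exists_coord_eq hd (coord i w) (coord j u)
  obtain ⟨y, hyi, hyl⟩ := exists_coord_eq hd.swap (coord i w) (coord l u)
  have hx := coord_add_coord_add_coord hd x
  have hy := coord_add_coord_add_coord hd y
  -- The scale `η` keeps the perturbations, at most `2 * (M + 1) * η` in one coordinate, below the
  -- distances from `w` to the corners, and the points within `ε` of the corners.
  obtain ⟨η, hη, h1, h2, h3⟩ : ∃ η : ℝ, 0 < η ∧ 2 * (M + 1) * η < coord j u - coord j w ∧
      2 * (M + 1) * η < coord l u - coord l w ∧ 3 * (M + 1) * η ≤ ε := by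
    have hM : (0 : ℝ) < M + 1 := by positivity
    obtain ⟨δ, hδ, hδ'⟩ := exists_between (show (0 : ℝ) < min ε
      (min (coord j u - coord j w) (coord l u - coord l w)) by
        refine lt_min hε (lt_min ?_ ?_) <;> linarith)
    rw [lt_min_iff, lt_min_iff] at hδ'
    have e : (M + 1) * (δ / (3 * (M + 1))) = δ / 3 := by field_simp
    refine ⟨δ / (3 * (M + 1)), by positivity, ?_, ?_, ?_⟩ <;> rw [mul_assoc, e] <;>
      linarith [hδ'.1, hδ'.2.1, hδ'.2.2]
  -- Coordinate `i` falls by `2 * n * η`, so both other coordinates can rise by `n * η` with `n`;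
  -- the initial offset `(M + 1) * η` keeps the points strictly inside the cone.
  have hex : ∀ n : ℕ, ∃ v : Plane, (n = 0 → v = w) ∧
      (n % 2 = 1 → coord i v = coord i w - 2 * n * η ∧
        coord j v = coord j u - (M + 1 - n) * η ∧
        coord l v = coord l w - (coord j u - coord j w) + (M + 1 + n) * η) ∧
      (0 < n → n % 2 = 0 → coord i v = coord i w - 2 * n * η ∧
        coord j v = coord j w - (coord l u - coord l w) + (M + 1 + n) * η ∧
        coord l v = coord l u - (M + 1 - n) * η) := by
    intro n
    obtain rfl | hn := Nat.eq_zero_or_pos n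
    · exact ⟨w, by simp⟩
    rcases Nat.mod_two_eq_zero_or_one n with h | h
    · obtain ⟨v, hv1, hv2⟩ := exists_coord_eq hd.swap (coord i w - 2 * n * η)
        (coord l u - (M + 1 - n) * η)
      refine ⟨v, by omega, by omega, fun _ _ => ⟨hv1, ?_, hv2⟩⟩
      linarith [coord_add_coord_add_coord hd v]
    · obtain ⟨v, hv1, hv2⟩ := exists_coord_eq hd (coord i w - 2 * n * η)
        (coord j u - (M + 1 - n) * η)
      refine ⟨v, by omega, fun _ => ⟨hv1, hv2, ?_⟩, by omega⟩
      linarith [coord_add_coord_add_coord hd v]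
  choose c h0 hodd heven using hex
  have hci : ∀ n, coord i (c n) = coord i w - 2 * n * η := by
    intro n
    obtain rfl | hn := Nat.eq_zero_or_pos n
    · simp [h0 0 rfl]
    rcases Nat.mod_two_eq_zero_or_one n with h | h
    exacts [(heven n hn h).1, (hodd n h).1]
  have hM0 : 0 ≤ (M : ℝ) * η := by positivity
  have hpos : ∀ n : ℕ, 0 ≤ (n : ℝ) * η := fun n => by positivity
  have hle : ∀ n ≤ M, (n : ℝ) * η ≤ M * η := fun n hn => by gcongr
  have hlt : ∀ a b : ℕ, a < b → (a : ℝ) * η < b * η := fun a b hab => by gcongr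
  have hcases : ∀ a, a = 0 ∨ a % 2 = 1 ∨ (0 < a ∧ a % 2 = 0) := fun a => by omega
  refine ⟨c, x, y, ⟨hd, ?_, ?_, ?_, ?_, ?_, ?_, ?_, ?_, ?_, ?_⟩, h0 0 rfl, ?_, ?_, ?_, ?_, ?_, ?_⟩
  · intro a b hab hb
    rw [hci, hci]; linarith [hlt a b hab]
  · intro a ha
    rw [hci]; linarith [hle a ha]
  · intro a ha
    rcases hcases a with rfl | h | ⟨h, h'⟩
    · rwa [h0 0 rfl]
    · rw [(hodd a h).2.1]; linarith [hle a ha]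
    · rw [(heven a h h').2.1]; linarith [hle a ha]
  · intro a ha
    rcases hcases a with rfl | h | ⟨h, h'⟩
    · rwa [h0 0 rfl]
    · rw [(hodd a h).2.2]; linarith [hle a ha]
    · rw [(heven a h h').2.2]; linarith [hle a ha]
  · intro a ha h
    rw [h0 0 rfl, (hodd a h).2.1]; linarith [hpos a]
  · intro a ha h
    rw [h0 0 rfl, (hodd a h).2.2]; linarith [hle a ha]
  · intro a ha h h'
    rw [h0 0 rfl, (heven a h h').2.1]; linarith [hle a ha]
  · intro a ha h h'
    rw [h0 0 rfl, (heven a h h').2.2]; linarith [hpos a]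
  · intro a b ha hab hb h
    rcases Nat.mod_two_eq_zero_or_one a with h' | h'
    · rw [(heven a ha h').2.1, (heven b (by omega) (by omega)).2.1]; linarith [hlt a b hab]
    · rw [(hodd a h').2.1, (hodd b (by omega)).2.1]; linarith [hlt a b hab]
  · intro a b ha hab hb h
    rcases Nat.mod_two_eq_zero_or_one a with h' | h'
    · rw [(heven a ha h').2.2, (heven b (by omega) (by omega)).2.2]; linarith [hlt a b hab]
    · rw [(hodd a h').2.2, (hodd b (by omega)).2.2]; linarith [hlt a b hab]
  · rw [dist_eq_of_coord_eq hd.rotate.swap hxj.symm, hxi, abs_of_neg (by linarith)]; ring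
  · rw [dist_eq_of_coord_eq hd.rotate.rotate hyl.symm, hyi, abs_of_neg (by linarith)]; ring
  · rw [dist_eq_of_coord_eq hd (hxi.trans hyi.symm), abs_of_nonneg (by linarith)]; linarith
  · rw [dist_eq_of_coord_eq hd hxi.symm, hxj, abs_of_neg (by linarith)]; ring
  · rw [dist_eq_of_coord_eq hd.swap hyi.symm, hyl, abs_of_neg (by linarith)]; ring
  · intro n hn
    have h4 := hpos n
    have h5 := hle n hn
    constructor
    · intro h
      refine (dist_le hd _ _).trans ?_
      rw [hci, hxi, (hodd n h).2.1, hxj, abs_of_nonpos (by linarith), abs_of_nonpos (by linarith)]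
      linarith
    · intro h h'
      refine (dist_le hd.swap _ _).trans ?_
      rw [hci, hyi, (heven n h h').2.2, hyl, abs_of_nonpos (by linarith),
        abs_of_nonpos (by linarith)]
      linarith

/-! ### Lower estimates for route lengths -/

namespace LocalRouting

variable {k : ℕ} (A : LocalRouting k) {P : Finset Plane} {s t : Plane}

theorem route_mem (hP : GeneralPosition (P : Set Plane)) (hs : s ∈ P) (ht : t ∈ P) (n : ℕ) :
    A.route P s t n ∈ P := by
  induction n with
  | zero => exact hs
  | succ n ih =>
    rw [route]
    split_ifs with h
    · exact ht
    · exact (mem_of_adj (A.adj_forward P hP _ ih t ht h)).2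

theorem adj_route (hP : GeneralPosition (P : Set Plane)) (hs : s ∈ P) (ht : t ∈ P) {n : ℕ}
    (h : A.route P s t n ≠ t) :
    (halfTheta6Graph P).Adj (A.route P s t n) (A.route P s t (n + 1)) := by
  rw [route, if_neg h]
  exact A.adj_forward P hP _ (A.route_mem hP hs ht n) t ht h

theorem routeLength_eq_top (hP : GeneralPosition (P : Set Plane)) (hs : s ∈ P) (ht : t ∈ P)
    (h : ¬ A.Delivers P s t) : A.routeLength P s t = ∞ := by
  -- An undelivered message keeps moving along edges of length at least `δ`, so the series diverges.
  obtain ⟨δ, hδ, hmin⟩ := exists_pos_le_dist P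
  rw [← top_le_iff, ← ENNReal.tsum_const_eq_top_of_ne_zero (α := ℕ) (c := ENNReal.ofReal δ)
    (by simpa using hδ)]
  refine ENNReal.tsum_le_tsum fun n => ?_
  have hadj := A.adj_route hP hs ht (n := n) fun e => h ⟨n, e⟩
  rw [edist_dist]
  exact ENNReal.ofReal_le_ofReal (hmin _ (mem_of_adj hadj).1 _ (mem_of_adj hadj).2 hadj.ne)

/-- If `t` has only one neighbour `z`, then every route to `t` has to pass it. -/
theorem le_routeLength (hP : GeneralPosition (P : Set Plane)) (hs : s ∈ P) (ht : t ∈ P)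
    (hst : s ≠ t) {x z : Plane} (hx : A.forward s t (neighbourhood P k s) = x) (hxt : x ≠ t)
    (hz : ∀ v, (halfTheta6Graph P).Adj t v → v = z) :
    edist s x + (edist x z + edist z t) ≤ A.routeLength P s t := by
  classical
  by_cases hd : A.Delivers P s t
  swap
  · simp [A.routeLength_eq_top hP hs ht hd]
  have hr1 : A.route P s t 1 = x := by
    rw [A.route_succ_of_ne hst, hx, route]
  obtain ⟨n, hn, hmin⟩ : ∃ n, A.route P s t n = t ∧ ∀ m < n, A.route P s t m ≠ t :=
    ⟨Nat.find hd, Nat.find_spec hd, fun m hm => Nat.find_min hd hm⟩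
  -- The first step ends at `x ≠ t`, so there are at least two steps; the last one starts at `z`.
  obtain ⟨n, rfl⟩ : ∃ m, n = m + 2 := by
    refine ⟨n - 2, ?_⟩
    have h0 : n ≠ 0 := by rintro rfl; exact hst hn
    have h1 : n ≠ 1 := by rintro rfl; exact hxt (hr1.symm.trans hn)
    omega
  have hadj := A.adj_route hP hs ht (hmin (n + 1) (by omega))
  rw [hn] at hadj
  have hrz := hz _ hadj.symm
  have e1 : edist s x = edist (A.route P s t 0) (A.route P s t (0 + 1)) := by
    rw [hr1, route]
  have e2 := edist_le_Ico_sum_edist (A.route P s t) (show 1 ≤ n + 1 by omega)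
  rw [hr1, hrz] at e2
  have e3 : edist z t = edist (A.route P s t (n + 1)) (A.route P s t (n + 1 + 1)) := by
    rw [hrz, hn]
  calc _ ≤ edist (A.route P s t 0) (A.route P s t (0 + 1)) +
        ((∑ m ∈ Finset.Ico 1 (n + 1), edist (A.route P s t m) (A.route P s t (m + 1))) +
        edist (A.route P s t (n + 1)) (A.route P s t (n + 1 + 1))) := by
        rw [e1, e3]; gcongr
    _ = ∑ m ∈ Finset.range (n + 2), edist (A.route P s t m) (A.route P s t (m + 1)) := by
        rw [← Finset.sum_Ico_succ_top (by omega), Finset.range_eq_Ico,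
          Finset.sum_eq_sum_Ico_succ_bot (show 0 < n + 2 by omega)]
    _ ≤ _ := ENNReal.sum_le_tsum _

theorem edist_add_edist_le_routeLength (hP : GeneralPosition (P : Set Plane)) (hs : s ∈ P)
    (ht : t ∈ P) (hst : s ≠ t) :
    edist s (A.forward s t (neighbourhood P k s)) +
      edist (A.forward s t (neighbourhood P k s)) t ≤ A.routeLength P s t := by
  by_cases hd : A.Delivers P s t
  swap
  · simp [A.routeLength_eq_top hP hs ht hd]
  obtain ⟨n, hn⟩ := hd
  obtain ⟨n, rfl⟩ := Nat.exists_eq_succ_of_ne_zero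
    (show n ≠ 0 by rintro rfl; exact hst hn)
  rw [Nat.succ_eq_add_one, A.route_succ_of_ne hst] at hn
  rw [A.routeLength_of_ne hst]
  gcongr
  have := edist_le_range_sum_edist (A.route P (A.forward s t (neighbourhood P k s)) t) n
  rw [hn] at this
  exact this.trans (ENNReal.sum_le_tsum _)

end LocalRouting

/-! ### Lower bounds for routing and spanning -/

theorem exists_unique_neighbour {i j l : Fin 3} {u w : Plane} (hc : InCone i j l u w) {ε : ℝ}
    (hε : 0 < ε) : ∃ (P : Finset Plane) (z : Plane), GeneralPosition (P : Set Plane) ∧ u ∈ P ∧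
      w ∈ P ∧ z ≠ w ∧ (∀ v, (halfTheta6Graph P).Adj u v → v = z) ∧
      positiveBound i u w - ε < dist u z + dist z w := by
  obtain ⟨c, x, y, hz, rfl, hux, huy, -, hwx, hwy, hnear⟩ :=
    exists_zigzag hc 2 (show 0 < ε / 3 by positivity)
  have key : ∀ m ≤ 2, 0 < m → positiveBound i u (c 0) - ε < dist u (c m) + dist (c m) (c 0) →
      ∃ (P : Finset Plane) (z : Plane), GeneralPosition (P : Set Plane) ∧ u ∈ P ∧
      c 0 ∈ P ∧ z ≠ c 0 ∧ (∀ v, (halfTheta6Graph P).Adj u v → v = z) ∧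
      positiveBound i u (c 0) - ε < dist u z + dist z (c 0) := fun m hm h0 h =>
    ⟨zigzagSet u c m, c m, hz.generalPosition hm, apex_mem_zigzagSet,
      point_mem_zigzagSet (Nat.zero_le _), fun e => h0.ne' (hz.eq_of_eq hm (by omega) e),
      fun v hv => hz.eq_of_adj_apex hm hv, h⟩
  -- The zigzag is stopped at the corner farther from `w`: index 2 for one corner, index 1 for the
  -- other.
  rcases le_total (coord j u - coord j (c 0)) (coord l u - coord l (c 0)) with hle | hle
  · refine key 2 le_rfl (by omega) ?_
    rw [positiveBound_eq hc.1, max_eq_right hle]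
    have h1 := (hnear 2 le_rfl).2 (by omega) rfl
    have h2 := dist_triangle u (c 2) y
    have h3 := dist_triangle_right (c 0) y (c 2)
    rw [dist_comm (c 2) (c 0)]
    rw [dist_comm y] at h3
    linarith
  · refine key 1 (by omega) (by omega) ?_
    rw [positiveBound_eq hc.1, max_eq_left hle]
    have h1 := (hnear 1 (by omega)).1 rfl
    have h2 := dist_triangle u (c 1) x
    have h3 := dist_triangle_right (c 0) x (c 1)
    rw [dist_comm (c 1) (c 0)]
    rw [dist_comm x] at h3
    linarith

theorem ofReal_lt_of_lt_add {a : ℝ} {x y z : Plane} (hne : x ≠ y) (h : a < dist x y + dist y z) :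
    ENNReal.ofReal a < edist x y + edist y z := by
  have := dist_pos.2 hne
  rw [edist_dist, edist_dist, ← ENNReal.ofReal_add dist_nonneg dist_nonneg]
  exact (ENNReal.ofReal_lt_ofReal_iff (by positivity)).2 h

theorem exists_lt_routeLength_positive {k : ℕ} (A : LocalRouting k) {i j l : Fin 3} {u w : Plane}
    (hc : InCone i j l u w) {ε : ℝ} (hε : 0 < ε) :
    ∃ P : Finset Plane, GeneralPosition (P : Set Plane) ∧ u ∈ P ∧ w ∈ P ∧
      ENNReal.ofReal (positiveBound i u w - ε) < A.routeLength P u w := by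
  obtain ⟨P, z, hP, hu, hw, -, hadj, hlt⟩ := exists_unique_neighbour hc hε
  have huw : u ≠ w := fun e => by simpa [e] using hc.2.1
  have hf := A.adj_forward P hP u hu w hw huw
  have hlen := A.edist_add_edist_le_routeLength hP hu hw huw
  rw [hadj _ hf] at hlen hf
  exact ⟨P, hP, hu, hw, (ofReal_lt_of_lt_add hf.ne hlt).trans_le hlen⟩

/-- Adversary argument: the first step from `w` is the same for lengths `2 * k + 1` and `2 * k + 2`.
The length is then fixed so that the only neighbour of `u` is near the other corner, and the route
must go to one corner, cross to the other and descend to `u`. -/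
theorem exists_lt_routeLength_negative {k : ℕ} (A : LocalRouting k) {i j l : Fin 3} {u w : Plane}
    (hc : InCone i j l u w) {ε : ℝ} (hε : 0 < ε) :
    ∃ P : Finset Plane, GeneralPosition (P : Set Plane) ∧ u ∈ P ∧ w ∈ P ∧
      ENNReal.ofReal (negativeBound i u w - ε) < A.routeLength P w u := by
  obtain ⟨c, x, y, hz, rfl, hux, huy, hxy, hwx, hwy, hnear⟩ :=
    exists_zigzag hc (2 * k + 2) (show 0 < ε / 5 by positivity)
  have hwu : c 0 ≠ u := hz.ne_apex (Nat.zero_le _)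
  have hN : ∀ m ≤ 2 * k + 2, 2 * k < m →
      neighbourhood (zigzagSet u c m) k (c 0) = c '' {b | b ≤ 2 * k} :=
    fun m hm hk => hz.neighbourhood_eq hm hk
  obtain ⟨v, hv⟩ : ∃ v, A.forward (c 0) u (c '' {b | b ≤ 2 * k}) = v := ⟨_, rfl⟩
  have hadj : ∀ m ≤ 2 * k + 2, 2 * k < m → (halfTheta6Graph (zigzagSet u c m)).Adj (c 0) v := by
    intro m hm hk
    have := A.adj_forward _ (hz.generalPosition hm) (c 0) (point_mem_zigzagSet (Nat.zero_le _)) u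
      apex_mem_zigzagSet hwu
    rwa [hN m hm hk, hv] at this
  -- The first step cannot reach `u`, whose only neighbour is the last point of the zigzag.
  have hvu : v ≠ u := by
    rintro rfl
    have := hz.eq_of_eq (by omega) (by omega)
      (hz.eq_of_adj_apex (by omega) (hadj (2 * k + 1) (by omega) (by omega)).symm)
    omega
  obtain ⟨n, hn, rfl⟩ := (mem_zigzagSet.1
    (mem_of_adj (hadj (2 * k + 1) (by omega) (by omega))).2).resolve_left hvu
  have hn0 : 0 < n := by
    rcases Nat.eq_zero_or_pos n with rfl | h
    · exact absurd rfl (hadj (2 * k + 1) (by omega) (by omega)).ne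
    · exact h
  have key : ∀ m ≤ 2 * k + 2, 2 * k < m → negativeBound i u (c 0) - ε <
      dist (c 0) (c n) + (dist (c n) (c m) + dist (c m) u) → ∃ P : Finset Plane,
      GeneralPosition (P : Set Plane) ∧ u ∈ P ∧ c 0 ∈ P ∧
      ENNReal.ofReal (negativeBound i u (c 0) - ε) < A.routeLength P (c 0) u := by
    intro m hm hk hlt
    refine ⟨zigzagSet u c m, hz.generalPosition hm, apex_mem_zigzagSet,
      point_mem_zigzagSet (Nat.zero_le _), ?_⟩
    refine lt_of_lt_of_le ?_ (A.le_routeLength (hz.generalPosition hm)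
      (point_mem_zigzagSet (Nat.zero_le _)) apex_mem_zigzagSet hwu
      (by rw [hN m hm hk, hv]) hvu fun v hv => hz.eq_of_adj_apex hm hv)
    have := dist_pos.2 (hadj m hm hk).ne
    rw [edist_dist, edist_dist, edist_dist, ← ENNReal.ofReal_add dist_nonneg dist_nonneg,
      ← ENNReal.ofReal_add dist_nonneg (by positivity)]
    exact (ENNReal.ofReal_lt_ofReal_iff (by positivity)).2 hlt
  rw [negativeBound_eq hc.1] at key ⊢
  rcases Nat.mod_two_eq_zero_or_one n with h | h
  -- An even first vertex is near `y`, so an odd last index puts the access to `u` near `x`; the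
  -- other case is the reverse.
  · refine key (2 * k + 1) (by omega) (by omega) ?_
    have h1 := (hnear n (by omega)).2 hn0 h
    have h2 := (hnear (2 * k + 1) (by omega)).1 (by omega)
    have h3 := dist_triangle (c 0) (c n) y
    have h4 := dist_triangle4 x (c (2 * k + 1)) (c n) y
    have h5 := dist_triangle u (c (2 * k + 1)) x
    have h6 := min_le_right (coord j u - coord j (c 0)) (coord l u - coord l (c 0))
    rw [dist_comm x (c _), dist_comm (c (2 * k + 1)) (c n)] at h4
    rw [dist_comm u (c _)] at h5
    linarith
  · refine key (2 * k + 2) (by omega) (by omega) ?_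
    have h1 := (hnear n (by omega)).1 h
    have h2 := (hnear (2 * k + 2) (by omega)).2 (by omega) (by omega)
    have h3 := dist_triangle (c 0) (c n) x
    have h4 := dist_triangle4 x (c n) (c (2 * k + 2)) y
    have h5 := dist_triangle u (c (2 * k + 2)) y
    have h6 := min_le_left (coord j u - coord j (c 0)) (coord l u - coord l (c 0))
    rw [dist_comm x (c n)] at h4
    rw [dist_comm u (c _)] at h5
    linarith

theorem five_div_sqrt_three_le {k : ℕ} (A : LocalRouting k) {d : ℝ} (hA : A.IsCompetitive d) :
    5 / √3 ≤ d := by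
  have hd : Distinct 0 1 2 := by decide
  -- The worst position is on the bisector: side 2, distance `√3`, and the bound is `2 * 2 + 1 = 5`.
  obtain ⟨w, hw0, hw1⟩ := exists_coord_eq hd 2 (-1)
  have hw2 : coord 2 w = -1 := by linarith [coord_add_coord_add_coord hd w]
  have h0 : ∀ i, coord i 0 = 0 := fun i => by simp [coord]
  have hc : InCone 0 1 2 0 w := ⟨hd, by rw [hw1, h0]; norm_num, by rw [hw2, h0]; norm_num⟩
  have hdist : dist w 0 = √3 := by
    rw [← Real.sqrt_sq (dist_nonneg (x := w) (y := 0)), dist_sq_eq hd, hw0, hw1, h0, h0]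
    norm_num
  rw [div_le_iff₀ (by positivity)]
  refine le_of_forall_pos_lt_add fun ε hε => ?_
  obtain ⟨P, hP, hu, hw, hlt⟩ := exists_lt_routeLength_negative A hc (lt_min hε one_pos)
  have hlt' := hlt.trans_le (hA P hP w hw 0 hu).2
  rw [negativeBound_eq hd, hw0, hw1, hw2, h0, h0, h0, hdist, ENNReal.ofReal_lt_ofReal_iff'] at hlt'
  have := min_le_left ε 1
  norm_num at hlt'
  linarith [hlt'.1]

theorem dist_le_of_walk {G : SimpleGraph Plane} {u v : Plane} (p : G.Walk u v) :
    dist u v ≤ (p.darts.map fun e => dist e.fst e.snd).sum := by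
  induction p with
  | nil => simp
  | cons h p ih =>
    simp only [SimpleGraph.Walk.darts_cons, List.map_cons, List.sum_cons]
    exact (dist_triangle _ _ _).trans (by gcongr)

theorem two_le_of_isSpanner {d : ℝ} (h : IsSpanner d) : 2 ≤ d := by
  by_contra! hlt
  have hd : Distinct 0 1 2 := by decide
  obtain ⟨ε, hε, hε1, hε2⟩ : ∃ ε : ℝ, 0 < ε ∧ ε < 1 / 2 ∧ 2 * ε ≤ 2 - d := by
    refine ⟨min (1 / 4) ((2 - d) / 2), lt_min (by norm_num) (by linarith), ?_, ?_⟩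
    · exact (min_le_left _ _).trans_lt (by norm_num)
    · linarith [min_le_right (1 / 4) ((2 - d) / 2)]
  -- In a triangle of side 1, `w` is at distance `ε` from one corner, so every path out of the apex
  -- through the other corner has length at least about `1 + (1 - ε)`, whereas `dist 0 w ≤ 1`.
  obtain ⟨w, hw0, hw1⟩ := exists_coord_eq hd 1 (-ε)
  have hw2 : coord 2 w = -(1 - ε) := by linarith [coord_add_coord_add_coord hd w]
  have h0 : ∀ i, coord i 0 = 0 := fun i => by simp [coord]
  have hc : InCone 0 1 2 0 w := ⟨hd, by rw [hw1, h0]; linarith, by rw [hw2, h0]; linarith⟩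
  have hdist : dist 0 w ≤ 1 := by
    rw [← sq_le_one_iff₀ dist_nonneg, dist_sq_eq hd, hw0, hw1, h0, h0]
    nlinarith
  obtain ⟨P, z, hP, hu, hw, hzw, hadj, hlt'⟩ := exists_unique_neighbour hc hε
  obtain ⟨p, hp⟩ := h P hP 0 hu w hw
  rw [positiveBound_eq hd, hw0, hw1, hw2, h0, h0, h0, max_eq_right (by linarith)] at hlt'
  cases p with
  | nil => linarith [h0 0]
  | cons h p =>
    obtain rfl := hadj _ h
    simp only [SimpleGraph.Walk.darts_cons, List.map_cons, List.sum_cons] at hp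
    have := dist_le_of_walk p
    have := dist_nonneg (x := 0) (y := w)
    rcases le_total d 0 with hd0 | hd0 <;> nlinarith

end HalfTheta6

theorem mainTheorem3 :
    -- One 1-local 0-memory algorithm attains both bounds, and has routing ratio `5 / √3`.
    (∃ A : HalfTheta6.LocalRouting 1,
      (∀ P : Finset Plane, HalfTheta6.GeneralPosition (P : Set Plane) →
        ∀ u ∈ P, ∀ w ∈ P, ∀ i : Fin 3, w ∈ HalfTheta6.positiveCone i u →
          (A.Delivers P u w ∧
            A.routeLength P u w ≤ ENNReal.ofReal (HalfTheta6.positiveBound i u w)) ∧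
          (A.Delivers P w u ∧
            A.routeLength P w u ≤ ENNReal.ofReal (HalfTheta6.negativeBound i u w))) ∧
      IsLeast {d : ℝ | A.IsCompetitive d} (5 / √3)) ∧
    -- Both bounds are best possible, for every `k` and every position of `u` and `w`.
    (∀ (k : ℕ) (A : HalfTheta6.LocalRouting k) (i : Fin 3) (u w : Plane),
      HalfTheta6.GeneralPosition {u, w} → w ∈ HalfTheta6.positiveCone i u →
      ∀ ε : ℝ, 0 < ε →
        (∃ P : Finset Plane, HalfTheta6.GeneralPosition (P : Set Plane) ∧ u ∈ P ∧ w ∈ P ∧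
          ENNReal.ofReal (HalfTheta6.positiveBound i u w - ε) < A.routeLength P u w) ∧
        (∃ P : Finset Plane, HalfTheta6.GeneralPosition (P : Set Plane) ∧ u ∈ P ∧ w ∈ P ∧
          ENNReal.ofReal (HalfTheta6.negativeBound i u w - ε) < A.routeLength P w u)) ∧
    -- No `k`-local 0-memory algorithm has a routing ratio below `5 / √3`.
    (∀ (k : ℕ) (A : HalfTheta6.LocalRouting k) (d : ℝ), A.IsCompetitive d → 5 / √3 ≤ d) ∧
    -- The spanning ratio is 2.
    IsLeast {d : ℝ | HalfTheta6.IsSpanner d} 2 := by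
  refine ⟨⟨HalfTheta6.stepRouting, fun P hP u hu w hw i hc => ?_,
    HalfTheta6.isCompetitive_stepRouting, fun d hd => HalfTheta6.five_div_sqrt_three_le _ hd⟩,
    fun k A i u w huw hw ε hε => ?_, fun k A d hd => HalfTheta6.five_div_sqrt_three_le A hd,
    HalfTheta6.isSpanner_two, fun d hd => HalfTheta6.two_le_of_isSpanner hd⟩
  · obtain ⟨h1, h2, -⟩ := HalfTheta6.stepRouting_of_potential hP hu hw
      (HalfTheta6.potential_positiveBound hP hu hw hc)
    obtain ⟨h3, h4, -⟩ := HalfTheta6.stepRouting_of_potential hP hw hu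
      (HalfTheta6.potential_negativeBound hP hu hw hc)
    exact ⟨⟨h1, h2⟩, h3, h4⟩
  · obtain ⟨j, l, hc⟩ := HalfTheta6.exists_inCone_of_mem huw (by simp) (by simp) hw
    exact ⟨HalfTheta6.exists_lt_routeLength_positive A hc hε,
      HalfTheta6.exists_lt_routeLength_negative A hc hε⟩
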